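/- Fix an integer $d\ge 1$ and let $\Delta=\Delta(n)$ be a sequence of integers with $\Delta\ge 3$ and $\Delta=n^{o(1)}$. Let $G_d(n,r)$ be the random geometric graph obtained from $n$ independent uniformly random points of $[0,1]^d$ by joining two distinct points whenever their Euclidean distance is at most $r$. Let $\mathcal{T}(n,\Delta)$ be the family of trees on $n$ vertices with maximum degree at most $\Delta$, and call a graph $\mathcal{T}(n,\Delta)$-universal if it contains every $T\in\mathcal{T}(n,\Delta)$ as a (not necessarily induced) subgraph. Then the function $$r_c=r_c(n,d,\Delta):=\frac{\sqrt d\,\log(\Delta-1)}{2\log n}$$ is a sharp threshold for $G_d(n,r)$ to be $\mathcal{T}(n,\Delta)$-universal; that is, for every $\varepsilon>0$, $\mathbb P(G_d(n,r)\text{ is }\mathcal{T}(n,\Delta)\text{-universal})$ tends to $0$ as $n\to\infty$ if $r=r(n)\le(1-\varepsilon)r_c$, and to $1$ if $r=r(n)\ge(1+\varepsilon)r_c$. More precisely, $$\lim_{n\to\infty}\mathbb P(G_d(n,r)\text{ is }\mathcal{T}(n,\Delta)\text{-universal})=\begin{cases}0,&\text{if } r=r(n)\le\left(1-\frac{\log(\Delta-1)}{\log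 n}\right)r_c,\\[2mm] 1,&\text{if } r=r(n)\ge\left(1+\frac{100d\log(\Delta\log n)}{\log n}\right)r_c.\end{cases}$$ -/

import Mathlib

open Filter Topology MeasureTheory
open scoped SimpleGraph

/-- The unit cube `[0,1]^d` in `d`-dimensional Euclidean space. -/
def unitCube (d : ℕ) : Set (EuclideanSpace ℝ (Fin d)) :=
  {x | ∀ i, x i ∈ Set.Icc (0 : ℝ) 1}

/-- The joint law of `n` independent uniformly random points of `[0,1]^d`. -/
noncomputable def uniformPoints (d n : ℕ) : Measure (Fin n → EuclideanSpace ℝ (Fin d)) :=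
  Measure.pi fun _ => (volume : Measure (EuclideanSpace ℝ (Fin d))).restrict (unitCube d)

/-- The geometric graph of a family of points: two distinct indices are adjacent when the
Euclidean distance between the corresponding points is at most `r`. -/
def geometricGraph {d n : ℕ} (x : Fin n → EuclideanSpace ℝ (Fin d)) (r : ℝ) :
    SimpleGraph (Fin n) where
  Adj i j := i ≠ j ∧ dist (x i) (x j) ≤ r
  symm := ⟨fun _ _ h => ⟨h.1.symm, dist_comm (x _) (x _) ▸ h.2⟩⟩
  loopless := ⟨fun _ h => h.1 rfl⟩

/-- The probability that the random geometric graph `G_d(n,r)` satisfies `P`. -/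
noncomputable def rggProb (d n : ℕ) (r : ℝ) (P : SimpleGraph (Fin n) → Prop) : ENNReal :=
  uniformPoints d n {x | P (geometricGraph x r)}

/-- `G` contains, as a not necessarily induced subgraph, every tree on `n` vertices
with maximum degree at most `Δ`. -/
def IsTreeUniversal (n Δ : ℕ) {V : Type*} (G : SimpleGraph V) : Prop :=
  ∀ (T : SimpleGraph (Fin n)) [DecidableRel T.Adj], T.IsTree → T.maxDegree ≤ Δ → T ⊑ G

/-- `rc` is a sharp threshold for the sequence of graph properties `P` in `G_d(n,r)`. -/
def IsSharpThreshold (d : ℕ) (P : (n : ℕ) → SimpleGraph (Fin n) → Prop) (rc : ℕ → ℝ) : Prop :=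
  ∀ ε : ℝ, 0 < ε → ∀ r : ℕ → ℝ,
    ((∀ᶠ n in atTop, r n ≤ (1 - ε) * rc n) →
      Tendsto (fun n => rggProb d n (r n) (P n)) atTop (𝓝 0)) ∧
    ((∀ᶠ n in atTop, (1 + ε) * rc n ≤ r n) →
      Tendsto (fun n => rggProb d n (r n) (P n)) atTop (𝓝 1))

/-- `Δ(n) = n^{o(1)}`. -/
def IsSubpolynomial (Δ : ℕ → ℕ) : Prop :=
  ∃ e : ℕ → ℝ, Tendsto e atTop (𝓝 0) ∧ ∀ᶠ n : ℕ in atTop, (Δ n : ℝ) = (n : ℝ) ^ e n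

/-- The critical radius `√d log(Δ - 1) / (2 log n)`. -/
noncomputable def criticalRadius (d n Δ : ℕ) : ℝ :=
  Real.sqrt d * Real.log ((Δ : ℝ) - 1) / (2 * Real.log n)

/-!
The probabilistic input is a single event: for a grid of `(log n) ^ O(1)` cells, with high
probability every cell contains at least `n / (log n) ^ O(1)` of the random points
(`uniformPoints_compl_wellSpread_le`). Given this event, both bounds are deterministic. Write
`k = Δ - 1`.

Lower bound (`not_isTreeUniversal_of_le`). The complete `k`-ary tree on `n` vertices has depth at
most `log n / log k + 1`, so any two points of a spanning copy of it are joined by a path of at most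
twice as many edges, each of length at most `r`. Since some two points lie near opposite corners of
the cube, at distance nearly `√d`, the radius `r` cannot be much smaller than the critical one.

Upper bound (`isTreeUniversal_of_le`). In a tree with maximum degree at most `Δ`, remove a small
set `C` of vertices such that the remaining pieces are small
(`SimpleGraph.IsTree.exists_separator`). Put `C` at the centre of the cube, give every piece a
target cell so that each cell receives about as many vertices as it has points
(`exists_assignment_le_add`), and place a vertex at graph distance `j` from `C` at the fraction
`min 1 (j / h)` of the way from the centre to its target, where `h` is slightly less than
`log n / log k`. Adjacent vertices are then at distance at most `√d / (2 h)`, a bit less than `r`,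
because vertices of different pieces are not adjacent. Only about `|C| k ^ h` vertices, a negligible
number, have not arrived at their target (`card_level_lt_le`), so the positions are distributed
almost like the random points. As the grid is connected, Hall's theorem matches the positions with
the points such that matched pairs lie in touching cells (`exists_injective_of_excess_le`), and
the slack in `r` absorbs this last displacement.
-/

/-! ### Separators of rooted trees -/

/-- A tree rooted at `ρ` is recorded by its parent map and a depth function. -/
theorem SimpleGraph.IsTree.exists_parent {V : Type*} {T : SimpleGraph V} (hT : T.IsTree) (ρ : V) :
    ∃ (par : V → V) (depth : V → ℕ), par ρ = ρ ∧ (∀ v, v ≠ ρ → depth (par v) < depth v) ∧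
      ∀ u v, T.Adj u v → u = par v ∨ v = par u := by
  choose p hp hlen using fun v => hT.connected.exists_path_of_dist ρ v
  have key : ∀ u v, T.Adj u v → T.dist ρ v = T.dist ρ u + 1 → u = (p v).penultimate := by
    intro u v huv hd
    have hpath : ((p u).concat huv).IsPath := by
      apply SimpleGraph.Walk.isPath_of_length_eq_dist
      rw [SimpleGraph.Walk.length_concat, hlen, hd]
    have h : (p u).concat huv = p v := congrArg Subtype.val
      ((hT.isAcyclic.subsingleton_path ρ v).elim ⟨_, hpath⟩ ⟨p v, hp v⟩)
    rw [← h, SimpleGraph.Walk.penultimate_concat]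
  refine ⟨fun v => (p v).penultimate, T.dist ρ, ?_, ?_, ?_⟩
  · have : (p ρ).length = 0 := by rw [hlen]; simp
    simp [SimpleGraph.Walk.penultimate, this]
  · intro v hv
    have hnil : ¬ (p v).Nil := SimpleGraph.Walk.not_nil_of_ne (Ne.symm hv)
    have h1 := SimpleGraph.dist_le (p v).dropLast
    have h2 : (p v).length ≠ 0 := by
      intro h
      exact hv (SimpleGraph.Walk.eq_of_length_eq_zero h).symm
    have h3 : (p v).dropLast.length = (p v).length - 1 := by simp
    rw [hlen] at h3 h2
    show T.dist ρ (p v).penultimate < _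
    omega
  · intro u v huv
    rcases hT.dist_eq_dist_add_one_of_adj ρ huv with h | h
    · exact Or.inr (key v u huv.symm h)
    · exact Or.inl (key u v huv h)

section Separator

variable {V : Type*} {par : V → V} {depth : V → ℕ} {ρ : V}

theorem depth_iterate_le (hρ : par ρ = ρ) (hdepth : ∀ v, v ≠ ρ → depth (par v) < depth v)
    (v : V) (i : ℕ) : depth (par^[i] v) ≤ depth v := by
  induction i with
  | zero => simp
  | succ i ih =>
    rw [Function.iterate_succ_apply']
    by_cases h : par^[i] v = ρ
    · rw [h] at ih ⊢
      rwa [hρ]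
    · exact (hdepth _ h).le.trans ih

theorem exists_iterate_eq_root (hdepth : ∀ v, v ≠ ρ → depth (par v) < depth v) (v : V) :
    ∃ i, par^[i] v = ρ := by
  induction h : depth v using Nat.strong_induction_on generalizing v with
  | _ n ih =>
    by_cases hv : v = ρ
    · exact ⟨0, hv⟩
    · obtain ⟨i, hi⟩ := ih _ (h ▸ hdepth v hv) (par v) rfl
      exact ⟨i + 1, hi⟩

/-- Two children of the same vertex having a common descendant coincide. -/
theorem child_unique (hρ : par ρ = ρ) (hdepth : ∀ v, v ≠ ρ → depth (par v) < depth v)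
    {v u c c' : V} (hc : par c = v) (hcv : c ≠ v) (hc' : par c' = v) (hcv' : c' ≠ v)
    (hu : ∃ i, par^[i] u = c) (hu' : ∃ i, par^[i] u = c') : c = c' := by
  obtain ⟨i, hi⟩ := hu
  obtain ⟨j, hj⟩ := hu'
  have aux : ∀ (i j : ℕ) (c c' : V), par c = v → par c' = v → c' ≠ v →
      par^[i] u = c → par^[j] u = c' → i < j → False := by
    intro i j c c' hc hc' hcv' hi hj hij
    obtain ⟨t, rfl⟩ := Nat.exists_eq_add_of_lt hij
    have h1 : par^[t] v = c' := by
      rw [← hj, show i + t + 1 = t + 1 + i by ring, Function.iterate_add_apply, hi,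
        Function.iterate_succ_apply, hc]
    have h2 := depth_iterate_le hρ hdepth v t
    rw [h1] at h2
    have h3 : c' ≠ ρ := by
      rintro rfl
      exact hcv' (hρ.symm.trans hc')
    have := hdepth c' h3
    rw [hc'] at this
    omega
  rcases lt_trichotomy i j with h | h | h
  · exact (aux i j c c' hc hc' hcv' hi hj h).elim
  · subst h; exact hi.symm.trans hj
  · exact (aux j i c' c hc' hc hcv hj hi h).elim

/-- Separator lemma on a set of vertices closed under taking parents. The separator is built by
repeatedly picking a deepest vertex with at least `m` descendants: all its children have fewer than
`m` descendants, and its whole subtree is then discarded. The label of a vertex names the piece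
of the tree minus the separator in which it lies. -/
theorem exists_separator_of_closed [Fintype V] [DecidableEq V] (hρ : par ρ = ρ)
    (hdepth : ∀ v, v ≠ ρ → depth (par v) < depth v) {m : ℕ} (hm : 0 < m) (A : Finset V)
    (hA : ∀ v ∈ A, par v ∈ A) :
    ∃ (C : Finset V) (π : V → V), C ⊆ A ∧ C.card * m ≤ A.card ∧ (∀ v ∈ A, π v ∈ A) ∧
      (∀ v ∈ A, v ∉ C → par v ∉ C → π v = π (par v)) ∧
      ∀ y, (A.filter fun v => v ∉ C ∧ π v = y).card < m := by
  classical
  induction hN : A.card using Nat.strong_induction_on generalizing A with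
  | _ N ih =>
  have hiter : ∀ u ∈ A, ∀ i, par^[i] u ∈ A := by
    intro u hu i
    induction i with
    | zero => exact hu
    | succ i ih => rw [Function.iterate_succ_apply']; exact hA _ ih
  by_cases hlt : A.card < m
  · refine ⟨∅, fun _ => ρ, by simp, by simp, ?_, fun _ _ _ _ => rfl, ?_⟩
    · intro v hv
      obtain ⟨i, hi⟩ := exists_iterate_eq_root hdepth v
      exact hi ▸ hiter v hv i
    · intro y
      exact (Finset.card_le_card (Finset.filter_subset _ _)).trans_lt hlt
  set sub : V → Finset V := fun v => A.filter fun u => ∃ i, par^[i] u = v with hsub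
  have hbig : (A.filter fun v => m ≤ (sub v).card).Nonempty := by
    have hne : A.Nonempty := by
      rw [← Finset.card_pos]; omega
    obtain ⟨u, hu⟩ := hne
    obtain ⟨i, hi⟩ := exists_iterate_eq_root hdepth u
    refine ⟨ρ, Finset.mem_filter.2 ⟨hi ▸ hiter u hu i, ?_⟩⟩
    have : sub ρ = A := Finset.filter_true_of_mem fun u _ => exists_iterate_eq_root hdepth u
    rw [this]; omega
  obtain ⟨v, hv, hmax⟩ := Finset.exists_max_image _ depth hbig
  rw [Finset.mem_filter] at hv
  obtain ⟨hvA, hvm⟩ := hv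
  have hsubA : sub v ⊆ A := Finset.filter_subset _ _
  have hmem : ∀ u, u ∈ sub v ↔ u ∈ A ∧ ∃ i, par^[i] u = v := fun u => Finset.mem_filter
  have hcard : (A \ sub v).card + (sub v).card = A.card :=
    Finset.card_sdiff_add_card_eq_card hsubA
  obtain ⟨C, π, hCA, hCm, hπA, hπ, hsmall⟩ := ih (A \ sub v).card (by omega) (A \ sub v) (by
    intro u hu
    rw [Finset.mem_sdiff] at hu ⊢
    refine ⟨hA _ hu.1, fun h => hu.2 ?_⟩
    obtain ⟨-, i, hi⟩ := (hmem _).1 h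
    exact (hmem _).2 ⟨hu.1, i + 1, hi⟩) rfl
  have hchild : ∀ u ∈ sub v, u ≠ v → ∃ c, par c = v ∧ c ≠ v ∧ ∃ i, par^[i] u = c := by
    intro u hu huv
    have hex := ((hmem u).1 hu).2
    obtain ⟨i, hi⟩ : ∃ i, Nat.find hex = i + 1 := by
      refine Nat.exists_eq_succ_of_ne_zero fun h => huv ?_
      have := Nat.find_spec hex
      rwa [h] at this
    refine ⟨par^[i] u, ?_, ?_, i, rfl⟩
    · rw [← Function.iterate_succ_apply' par, ← Nat.succ_eq_add_one] at *
      have := Nat.find_spec hex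
      rwa [hi] at this
    · exact Nat.find_min hex (by omega)
  choose! ch hch1 hch2 hch3 using hchild
  refine ⟨insert v C, fun u => if u ∈ sub v then (if u = v then v else ch u) else π u,
    ?_, ?_, ?_, ?_, ?_⟩
  · intro u hu
    rcases Finset.mem_insert.1 hu with rfl | hu
    · exact hvA
    · exact (Finset.mem_sdiff.1 (hCA hu)).1
  · have := Finset.card_insert_le v C
    have h2 : (insert v C).card * m ≤ (C.card + 1) * m := Nat.mul_le_mul_right _ this
    rw [add_mul, one_mul] at h2
    omega
  · intro u hu
    show (if u ∈ sub v then (if u = v then v else ch u) else π u) ∈ A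
    split_ifs with h1 h2
    · exact hvA
    · obtain ⟨i, hi⟩ := hch3 u h1 h2
      exact hi ▸ hiter u hu i
    · exact (Finset.mem_sdiff.1 (hπA u (Finset.mem_sdiff.2 ⟨hu, h1⟩))).1
  · intro u hu huC hpC
    simp only [Finset.mem_insert, not_or] at huC hpC
    show (if u ∈ sub v then (if u = v then v else ch u) else π u) =
      (if par u ∈ sub v then (if par u = v then v else ch (par u)) else π (par u))
    by_cases h1 : u ∈ sub v
    · have h2 : par u ∈ sub v := by
        obtain ⟨-, i, hi⟩ := (hmem _).1 h1
        refine (hmem _).2 ⟨hA _ hu, ?_⟩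
        cases i with
        | zero => exact (huC.1 hi).elim
        | succ i => exact ⟨i, hi⟩
      rw [if_pos h1, if_pos h2, if_neg huC.1, if_neg hpC.1]
      obtain ⟨i, hi⟩ := hch3 _ h2 hpC.1
      exact child_unique hρ hdepth (hch1 u h1 huC.1) (hch2 u h1 huC.1)
        (hch1 _ h2 hpC.1) (hch2 _ h2 hpC.1) (hch3 u h1 huC.1) ⟨i + 1, hi⟩
    · have h2 : par u ∉ sub v := by
        intro h
        obtain ⟨-, i, hi⟩ := (hmem _).1 h
        exact h1 ((hmem _).2 ⟨hu, i + 1, hi⟩)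
      rw [if_neg h1, if_neg h2]
      exact hπ u (Finset.mem_sdiff.2 ⟨hu, h1⟩) huC.2 hpC.2
  · intro y
    by_cases hy : y ∈ sub v
    · -- The piece labelled `y` consists of descendants of the child `y` of `v`.
      by_cases hyv : par y = v ∧ y ≠ v
      · refine (Finset.card_le_card (t := sub y) ?_).trans_lt ?_
        · intro u hu
          simp only [Finset.mem_filter, Finset.mem_insert, not_or] at hu
          obtain ⟨huA, ⟨huv, huC⟩, hlab⟩ := hu
          by_cases h1 : u ∈ sub v
          · rw [if_pos h1, if_neg huv] at hlab
            exact Finset.mem_filter.2 ⟨huA, hlab ▸ hch3 u h1 huv⟩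
          · rw [if_neg h1] at hlab
            have := hπA u (Finset.mem_sdiff.2 ⟨huA, h1⟩)
            rw [hlab, Finset.mem_sdiff] at this
            exact (this.2 hy).elim
        · by_contra hcon
          rw [not_lt] at hcon
          have h1 := hmax y (Finset.mem_filter.2 ⟨hsubA hy, hcon⟩)
          have h2 : y ≠ ρ := by
            rintro rfl
            exact hyv.2 (hρ.symm.trans hyv.1)
          have h3 := hdepth y h2
          rw [hyv.1] at h3
          omega
      · rw [Finset.card_eq_zero.2 ?_]
        · exact hm
        rw [Finset.filter_eq_empty_iff]
        rintro u huA ⟨huC, hlab⟩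
        beta_reduce at hlab
        simp only [Finset.mem_insert, not_or] at huC
        by_cases h1 : u ∈ sub v
        · rw [if_pos h1, if_neg huC.1] at hlab
          exact hyv ⟨hlab ▸ hch1 u h1 huC.1, hlab ▸ hch2 u h1 huC.1⟩
        · rw [if_neg h1] at hlab
          have := hπA u (Finset.mem_sdiff.2 ⟨huA, h1⟩)
          rw [hlab, Finset.mem_sdiff] at this
          exact this.2 hy
    · refine (Finset.card_le_card ?_).trans_lt (hsmall y)
      intro u hu
      simp only [Finset.mem_filter, Finset.mem_insert, not_or, Finset.mem_sdiff] at hu ⊢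
      obtain ⟨huA, ⟨huv, huC⟩, hlab⟩ := hu
      by_cases h1 : u ∈ sub v
      · rw [if_pos h1, if_neg huv] at hlab
        obtain ⟨i, hi⟩ := hch3 u h1 huv
        refine (hy ((hmem y).2 ⟨hlab ▸ hi ▸ hiter u huA i, 1, ?_⟩)).elim
        simpa [hlab] using hch1 u h1 huv
      · rw [if_neg h1] at hlab
        exact ⟨⟨huA, h1⟩, huC, hlab⟩

end Separator

/-- A tree has a nonempty set `C` of at most `n / m + 1` vertices whose removal leaves pieces,
recorded by the labelling `π`, with fewer than `m` vertices each. -/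
theorem SimpleGraph.IsTree.exists_separator {V : Type*} [Fintype V] [DecidableEq V]
    {T : SimpleGraph V} (hT : T.IsTree) {m : ℕ} (hm : 0 < m) :
    ∃ (C : Finset V) (π : V → V), C.Nonempty ∧ C.card ≤ Fintype.card V / m + 1 ∧
      (∀ u v, T.Adj u v → u ∉ C → v ∉ C → π u = π v) ∧
      ∀ y, (Finset.univ.filter fun v => v ∉ C ∧ π v = y).card ≤ m := by
  obtain ⟨ρ⟩ := hT.connected.nonempty
  obtain ⟨par, depth, hρ, hdepth, hadj⟩ := hT.exists_parent ρ
  obtain ⟨C, π, -, hC, -, hπ, hsmall⟩ :=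
    exists_separator_of_closed hρ hdepth hm Finset.univ fun _ _ => Finset.mem_univ _
  refine ⟨insert ρ C, π, Finset.insert_nonempty _ _, ?_, ?_, ?_⟩
  · refine (Finset.card_insert_le _ _).trans (Nat.succ_le_succ ?_)
    exact (Nat.le_div_iff_mul_le hm).2 (by simpa using hC)
  · intro u v huv hu hv
    rw [Finset.mem_insert, not_or] at hu hv
    rcases hadj u v huv with rfl | rfl
    · exact (hπ v (Finset.mem_univ _) hv.2 hu.2).symm
    · exact hπ u (Finset.mem_univ _) hu.2 hv.2
  · intro y
    refine (Finset.card_le_card ?_).trans (hsmall y).le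
    intro v hv
    simp only [Finset.mem_filter, Finset.mem_univ, true_and, Finset.mem_insert, not_or] at hv ⊢
    exact ⟨hv.1.2, hv.2⟩

/-! ### Growth of the levels around a vertex set -/

/-- If `D` behaves like the distance to the set `{D = 0}` in a graph of maximum degree at most
`k + 1`, then at most `2 k ^ h` vertices per vertex of that set have level below `h`. Each
vertex of positive level has a neighbour one level closer, so only `k` further ones. -/
theorem card_level_lt_le {V : Type*} [Fintype V] [DecidableEq V] (G : SimpleGraph V)
    [DecidableRel G.Adj] {k : ℕ} (hk : 2 ≤ k) (hdeg : G.maxDegree ≤ k + 1) (D : V → ℕ)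
    (hD : ∀ v, D v ≠ 0 → ∃ u, G.Adj v u ∧ D u + 1 = D v) (h : ℕ) :
    (Finset.univ.filter fun v => D v < h).card ≤
      2 * (Finset.univ.filter fun v => D v = 0).card * k ^ h := by
  set c := (Finset.univ.filter fun v => D v = 0).card with hc
  have hstep : ∀ j b : ℕ, (∀ v, D v = j →
      ((G.neighborFinset v).filter fun u => D u = j + 1).card ≤ b) →
      (Finset.univ.filter fun v => D v = j + 1).card ≤
        (Finset.univ.filter fun v => D v = j).card * b := by
    intro j b hb
    refine (Finset.card_le_card ?_).trans (Finset.card_biUnion_le_card_mul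
      (Finset.univ.filter fun v => D v = j)
      (fun v => (G.neighborFinset v).filter fun u => D u = j + 1) b ?_)
    · intro v hv
      rw [Finset.mem_filter] at hv
      obtain ⟨u, hu, huv⟩ := hD v (by omega)
      simp only [Finset.mem_biUnion, Finset.mem_filter, Finset.mem_univ, true_and,
        SimpleGraph.mem_neighborFinset]
      exact ⟨u, by omega, hu.symm, hv.2⟩
    · intro v hv
      exact hb v (Finset.mem_filter.1 hv).2
  have hdegv : ∀ v, (G.neighborFinset v).card ≤ k + 1 := fun v =>
    (G.degree_le_maxDegree v).trans hdeg
  have hlevel : ∀ j, (Finset.univ.filter fun v => D v = j + 1).card ≤ 2 * c * k ^ (j + 1) := by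
    intro j
    induction j with
    | zero =>
      refine (hstep 0 (k + 1) fun v _ =>
        (Finset.card_le_card (Finset.filter_subset _ _)).trans (hdegv v)).trans ?_
      rw [← hc, zero_add, pow_one, mul_comm 2 c, mul_assoc]
      exact Nat.mul_le_mul_left _ (by omega)
    | succ j ih =>
      refine (hstep (j + 1) k fun v hv => ?_).trans ?_
      · obtain ⟨u, hu, huv⟩ := hD v (by omega)
        have hlt : ((G.neighborFinset v).filter fun u => D u = j + 1 + 1).card <
            (G.neighborFinset v).card := by
          refine Finset.card_lt_card (Finset.filter_ssubset.2 ⟨u, ?_, by omega⟩)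
          simpa using hu
        have := hdegv v
        omega
      · rw [pow_succ k (j + 1), ← mul_assoc]
        exact Nat.mul_le_mul_right _ ih
  have hlevel' : ∀ j, (Finset.univ.filter fun v => D v = j).card ≤ 2 * c * k ^ j := by
    rintro (_ | j)
    · simp only [pow_zero, ← hc]; omega
    · exact hlevel j
  induction h with
  | zero => simp
  | succ h ih =>
    have hsub : (Finset.univ.filter fun v => D v < h + 1) ⊆
        (Finset.univ.filter fun v => D v < h) ∪ (Finset.univ.filter fun v => D v = h) := by
      intro v
      simp only [Finset.mem_filter, Finset.mem_univ, true_and, Finset.mem_union]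
      omega
    have h1 := (Finset.card_le_card hsub).trans (Finset.card_union_le _ _)
    have h2 := hlevel' h
    calc _ ≤ 2 * c * k ^ h + 2 * c * k ^ h := h1.trans (add_le_add ih h2)
      _ = 2 * c * k ^ h * 2 := by ring
      _ ≤ 2 * c * k ^ h * k := Nat.mul_le_mul_left _ hk
      _ = 2 * c * k ^ (h + 1) := by ring

/-- The graph distance to a nonempty vertex set of a connected graph. -/
theorem SimpleGraph.Connected.exists_level {V : Type*} {G : SimpleGraph V} (hG : G.Connected)
    {C : Finset V} (hC : C.Nonempty) :
    ∃ D : V → ℕ, (∀ v, D v = 0 ↔ v ∈ C) ∧ (∀ u v, G.Adj u v → D u ≤ D v + 1) ∧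
      ∀ v, D v ≠ 0 → ∃ u, G.Adj v u ∧ D u + 1 = D v := by
  have hle : ∀ v, ∀ c ∈ C, C.inf' hC (fun c => G.dist v c) ≤ G.dist v c := fun v c hc =>
    Finset.inf'_le _ hc
  have hex : ∀ v, ∃ c ∈ C, C.inf' hC (fun c => G.dist v c) = G.dist v c := fun v =>
    Finset.exists_mem_eq_inf' hC _
  have hadj : ∀ u v, G.Adj u v →
      C.inf' hC (fun c => G.dist u c) ≤ C.inf' hC (fun c => G.dist v c) + 1 := by
    intro u v huv
    obtain ⟨c, hc, hcv⟩ := hex v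
    have h1 := hle u c hc
    have h2 := hG.dist_triangle (u := u) (v := v) (w := c)
    rw [SimpleGraph.dist_eq_one_iff_adj.2 huv] at h2
    omega
  refine ⟨fun v => C.inf' hC fun c => G.dist v c, ?_, hadj, ?_⟩
  · intro v
    refine ⟨fun h => ?_, fun h => ?_⟩
    · obtain ⟨c, hc, hcv⟩ := hex v
      have : v = c := hG.dist_eq_zero_iff.1 (hcv.symm.trans h)
      exact this ▸ hc
    · have := hle v v h
      simpa using this
  · intro v hv
    obtain ⟨c, hc, hcv⟩ := hex v
    obtain ⟨p, hp⟩ := hG.exists_walk_length_eq_dist v c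
    cases p with
    | nil =>
      simp only [SimpleGraph.Walk.length_nil] at hp
      exact (hv (hcv.trans hp.symm)).elim
    | cons hvu q =>
      rename_i u
      refine ⟨u, hvu, ?_⟩
      have h1 := SimpleGraph.dist_le q
      have h2 := hle u c hc
      have h3 := hadj v u hvu
      simp only [SimpleGraph.Walk.length_cons] at hp
      show C.inf' hC (fun c => G.dist u c) + 1 = C.inf' hC (fun c => G.dist v c)
      omega

/-! ### Matching tree positions with points -/

/-- Greedy bin filling: items of size at most `m` whose total does not exceed the total capacity
can be distributed so that every bin overflows by at most `m`. -/
theorem exists_assignment_le_add {ι κ : Type*} [DecidableEq ι] [Fintype κ] [DecidableEq κ]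
    [Nonempty κ] (s : Finset ι) (w : ι → ℕ) (A : κ → ℕ) {m : ℕ} (hw : ∀ i ∈ s, w i ≤ m)
    (hsum : ∑ i ∈ s, w i ≤ ∑ c, A c) :
    ∃ f : ι → κ, ∀ c, ∑ i ∈ s with f i = c, w i ≤ A c + m := by
  induction s using Finset.induction_on with
  | empty => exact ⟨fun _ => Classical.arbitrary κ, fun c => by simp⟩
  | insert a s ha ih =>
    rw [Finset.sum_insert ha] at hsum
    obtain ⟨f, hf⟩ := ih (fun i hi => hw i (Finset.mem_insert_of_mem hi)) (by omega)
    have key : ∃ c, w a + ∑ i ∈ s with f i = c, w i ≤ A c + m := by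
      by_cases h0 : w a = 0
      · exact ⟨Classical.arbitrary κ, by rw [h0, zero_add]; exact hf _⟩
      · have hlt : ∑ c, ∑ i ∈ s with f i = c, w i < ∑ c, A c := by
          rw [Finset.sum_fiberwise]
          omega
        obtain ⟨c, -, hc⟩ := Finset.exists_lt_of_sum_lt hlt
        have := hw a (Finset.mem_insert_self _ _)
        exact ⟨c, by omega⟩
    obtain ⟨c, hc⟩ := key
    have hcongr : ∀ e, ∑ i ∈ s with Function.update f a c i = e, w i =
        ∑ i ∈ s with f i = e, w i := by
      intro e
      refine Finset.sum_congr (Finset.filter_congr fun i hi => ?_) fun _ _ => rfl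
      rw [Function.update_of_ne (by rintro rfl; exact ha hi)]
    refine ⟨Function.update f a c, fun e => ?_⟩
    rw [Finset.filter_insert, Function.update_self]
    by_cases hce : c = e
    · subst hce
      rw [if_pos rfl, Finset.sum_insert (by simp [ha]), hcongr]
      exact hc
    · rw [if_neg hce, hcongr]
      exact hf e

/-- Let `R` be a reflexive relation on cells such that every proper nonempty set of cells has a
related cell outside it, and let each cell contain at least `a` points. If every set of cells is
requested at most `a` times more often than it has points, then the requests can be matched
with points in related cells. This is Hall's condition: the extra cell outside the given
set makes up for the excess. -/
theorem exists_injective_of_excess_le {V W κ : Type*} [Fintype V] [Fintype W] [DecidableEq W]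
    [Fintype κ] [DecidableEq κ] (hVW : Fintype.card V = Fintype.card W) (R : κ → κ → Prop)
    (hrefl : ∀ c, R c c)
    (hconn : ∀ S : Finset κ, S.Nonempty → S ≠ Finset.univ → ∃ c ∈ S, ∃ e ∉ S, R c e)
    (p : V → κ) (x : W → κ) {a : ℕ} (ha : ∀ c, a ≤ (Finset.univ.filter fun i => x i = c).card)
    (hexcess : ∀ S : Finset κ, (Finset.univ.filter fun v => p v ∈ S).card ≤
      (Finset.univ.filter fun i => x i ∈ S).card + a) :
    ∃ σ : V → W, Function.Injective σ ∧ ∀ v, R (p v) (x (σ v)) := by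
  classical
  have hall := (Finset.all_card_le_biUnion_card_iff_exists_injective
    (fun v : V => Finset.univ.filter fun i : W => R (p v) (x i))).1 ?_
  · obtain ⟨σ, hσ, hR⟩ := hall
    exact ⟨σ, hσ, fun v => (Finset.mem_filter.1 (hR v)).2⟩
  intro X
  rcases X.eq_empty_or_nonempty with rfl | hX
  · simp
  by_cases hS : X.image p = Finset.univ
  · rw [show (X.biUnion fun v => Finset.univ.filter fun i : W => R (p v) (x i)) = Finset.univ from ?_]
    · rw [Finset.card_univ, ← hVW]
      exact Finset.card_le_univ X
    · refine Finset.eq_univ_of_forall fun i => ?_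
      obtain ⟨v, hv, hvi⟩ := Finset.mem_image.1 (hS ▸ Finset.mem_univ (x i))
      exact Finset.mem_biUnion.2 ⟨v, hv, by simp [hvi, hrefl]⟩
  · obtain ⟨c, hc, e, he, hce⟩ := hconn _ (hX.image p) hS
    calc X.card ≤ (Finset.univ.filter fun v => p v ∈ X.image p).card :=
          Finset.card_le_card fun v hv => by
            simpa using ⟨v, hv, rfl⟩
      _ ≤ (Finset.univ.filter fun i => x i ∈ X.image p).card + a := hexcess _
      _ ≤ (Finset.univ.filter fun i => x i ∈ X.image p).card +
            (Finset.univ.filter fun i => x i = e).card := Nat.add_le_add_left (ha e) _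
      _ = ((Finset.univ.filter fun i => x i ∈ X.image p) ∪
            (Finset.univ.filter fun i => x i = e)).card := by
          rw [Finset.card_union_of_disjoint]
          rw [Finset.disjoint_filter]
          rintro i - h1 rfl
          exact he h1
      _ ≤ _ := by
          refine Finset.card_le_card fun i hi => ?_
          rw [Finset.mem_union, Finset.mem_filter, Finset.mem_filter] at hi
          rw [Finset.mem_biUnion]
          rcases hi with ⟨-, hi⟩ | ⟨-, hi⟩
          · obtain ⟨v, hv, hvi⟩ := Finset.mem_image.1 hi
            exact ⟨v, hv, by simp [hvi, hrefl]⟩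
          · obtain ⟨v, hv, rfl⟩ := Finset.mem_image.1 hc
            exact ⟨v, hv, by simpa [hi] using hce⟩

/-! ### The grid of cells -/

/-- Two cells of the `q × ⋯ × q` grid touch if their indices differ by at most one in every
coordinate. -/
def GridTouch {d q : ℕ} (c e : Fin d → Fin q) : Prop :=
  ∀ i, (c i : ℕ) ≤ e i + 1 ∧ (e i : ℕ) ≤ c i + 1

theorem GridTouch.refl {d q : ℕ} (c : Fin d → Fin q) : GridTouch c c :=
  fun _ => ⟨Nat.le_succ _, Nat.le_succ _⟩

theorem exists_gridTouch_notMem {d q : ℕ} (S : Finset (Fin d → Fin q)) (hne : S.Nonempty)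
    (hS : S ≠ Finset.univ) : ∃ c ∈ S, ∃ e ∉ S, GridTouch c e := by
  by_contra! hcon
  apply hS
  refine Finset.eq_univ_of_forall fun e => ?_
  obtain ⟨c₀, hc₀⟩ := hne
  -- Move from `c₀` towards `e` by one step in all coordinates simultaneously.
  have key : ∀ t : ℕ, ∀ c ∈ S, (∀ i, (c i : ℕ) ≤ e i + t ∧ (e i : ℕ) ≤ c i + t) → e ∈ S := by
    intro t
    induction t with
    | zero =>
      intro c hc h
      have : c = e := by
        funext i
        have := h i
        exact Fin.ext (by omega)
      exact this ▸ hc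
    | succ t ih =>
      intro c hc h
      let c' : Fin d → Fin q := fun i =>
        ⟨max (min (c i + 1 : ℕ) (e i)) (c i - 1), by have := (e i).2; have := (c i).2; omega⟩
      have hval : ∀ i, (c' i : ℕ) = max (min (c i + 1 : ℕ) (e i)) (c i - 1) := fun _ => rfl
      have hc' : c' ∈ S := by
        by_contra hn
        refine hcon c hc c' hn fun i => ?_
        rw [hval]
        omega
      refine ih c' hc' fun i => ?_
      have := h i
      rw [hval]
      omega
  exact key q c₀ hc₀ fun i => ⟨by have := (c₀ i).2; omega, by have := (e i).2; omega⟩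

/-- The cell containing a point of the unit cube, in the grid of side length `1 / q`. Points on the
upper faces of the cube are put into the last cells. -/
noncomputable def gridCell {d q : ℕ} (hq : 0 < q) (x : EuclideanSpace ℝ (Fin d)) : Fin d → Fin q :=
  fun i => ⟨min ⌊(q : ℝ) * x i⌋₊ (q - 1), by omega⟩

theorem gridCell_bounds {d q : ℕ} (hq : 0 < q) {x : EuclideanSpace ℝ (Fin d)}
    (hx : x ∈ unitCube d) (i : Fin d) :
    ((gridCell hq x i : ℕ) : ℝ) ≤ q * x i ∧ (q : ℝ) * x i ≤ (gridCell hq x i : ℕ) + 1 := by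
  have h0 : 0 ≤ (q : ℝ) * x i := mul_nonneg (Nat.cast_nonneg _) (hx i).1
  have hval : ((gridCell hq x i : Fin q) : ℕ) = min ⌊(q : ℝ) * x i⌋₊ (q - 1) := rfl
  constructor
  · refine le_trans ?_ (Nat.floor_le h0)
    exact_mod_cast hval ▸ min_le_left _ _
  · rcases le_total ⌊(q : ℝ) * x i⌋₊ (q - 1) with h | h
    · rw [hval, min_eq_left h]
      exact (Nat.lt_floor_add_one _).le
    · rw [hval, min_eq_right h]
      have : ((q - 1 : ℕ) : ℝ) + 1 = q := by
        have : q - 1 + 1 = q := by omega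
        exact_mod_cast this
      rw [this]
      exact mul_le_of_le_one_right (Nat.cast_nonneg _) (hx i).2

theorem gridCell_eq_of_mem {d q : ℕ} (hq : 0 < q) {x : EuclideanSpace ℝ (Fin d)}
    {c : Fin d → Fin q}
    (h : ∀ i, ((c i : ℕ) : ℝ) ≤ q * x i ∧ (q : ℝ) * x i < (c i : ℕ) + 1) : gridCell hq x = c := by
  funext i
  have h1 : ⌊(q : ℝ) * x i⌋₊ = c i :=
    (Nat.floor_eq_iff ((Nat.cast_nonneg _).trans (h i).1)).2 (h i)
  have := (c i).2
  refine Fin.ext ?_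
  show min ⌊(q : ℝ) * x i⌋₊ (q - 1) = c i
  omega

theorem EuclideanSpace.norm_le_sqrt_mul {d : ℕ} {x : EuclideanSpace ℝ (Fin d)} {δ : ℝ}
    (hδ : 0 ≤ δ) (h : ∀ i, |x i| ≤ δ) : ‖x‖ ≤ Real.sqrt d * δ := by
  rw [EuclideanSpace.norm_eq, Real.sqrt_le_left (by positivity), mul_pow,
    Real.sq_sqrt (Nat.cast_nonneg _)]
  calc ∑ i, ‖x i‖ ^ 2 ≤ ∑ _i : Fin d, δ ^ 2 :=
        Finset.sum_le_sum fun i _ => pow_le_pow_left₀ (norm_nonneg _) (h i) 2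
    _ = d * δ ^ 2 := by simp

theorem dist_le_of_gridTouch {d q : ℕ} (hq : 0 < q) {x y : EuclideanSpace ℝ (Fin d)}
    (hx : x ∈ unitCube d) (hy : y ∈ unitCube d) (h : GridTouch (gridCell hq x) (gridCell hq y)) :
    dist x y ≤ Real.sqrt d * (2 / q) := by
  have hq' : (0 : ℝ) < q := by exact_mod_cast hq
  rw [dist_eq_norm]
  refine EuclideanSpace.norm_le_sqrt_mul (by positivity) fun i => ?_
  have h1 := gridCell_bounds hq hx i
  have h2 := gridCell_bounds hq hy i
  have h3 : ((gridCell hq x i : ℕ) : ℝ) ≤ (gridCell hq y i : ℕ) + 1 := by exact_mod_cast (h i).1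
  have h4 : ((gridCell hq y i : ℕ) : ℝ) ≤ (gridCell hq x i : ℕ) + 1 := by exact_mod_cast (h i).2
  rw [le_div_iff₀ hq', PiLp.sub_apply, ← abs_of_pos hq', ← abs_mul, abs_le]
  constructor <;> nlinarith

/-- The centre of the unit cube. -/
noncomputable def cubeCenter (d : ℕ) : EuclideanSpace ℝ (Fin d) := WithLp.toLp 2 fun _ => 1 / 2

/-- The centre of a grid cell. -/
noncomputable def cellCenter {d q : ℕ} (c : Fin d → Fin q) : EuclideanSpace ℝ (Fin d) :=
  WithLp.toLp 2 fun i => ((c i : ℕ) + 1 / 2) / q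

theorem gridCell_cellCenter {d q : ℕ} (hq : 0 < q) (c : Fin d → Fin q) :
    gridCell hq (cellCenter c) = c := by
  have hq' : (q : ℝ) ≠ 0 := by exact_mod_cast hq.ne'
  refine gridCell_eq_of_mem hq fun i => ?_
  simp only [cellCenter]
  rw [mul_div_cancel₀ _ hq']
  constructor <;> linarith

theorem cellCenter_mem {d q : ℕ} (c : Fin d → Fin q) : cellCenter c ∈ unitCube d := by
  intro i
  have hlt : ((c i : ℕ) : ℝ) + 1 ≤ q := by exact_mod_cast (c i).2
  have h0 : (0 : ℝ) ≤ ((c i : ℕ) : ℝ) := Nat.cast_nonneg _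
  simp only [cellCenter]
  constructor
  · positivity
  · rw [div_le_one (by linarith)]; linarith

theorem cubeCenter_mem (d : ℕ) : cubeCenter d ∈ unitCube d := by
  intro i
  simp only [cubeCenter]
  norm_num

theorem norm_sub_cubeCenter_le {d : ℕ} {x : EuclideanSpace ℝ (Fin d)} (hx : x ∈ unitCube d) :
    ‖x - cubeCenter d‖ ≤ Real.sqrt d * (1 / 2) := by
  refine EuclideanSpace.norm_le_sqrt_mul (by norm_num) fun i => ?_
  have := hx i
  rw [PiLp.sub_apply, abs_le]
  simp only [cubeCenter]
  constructor <;> linarith [this.1, this.2]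

theorem convex_unitCube (d : ℕ) : Convex ℝ (unitCube d) := by
  intro x hx y hy a b ha hb hab i
  have := convex_Icc (0 : ℝ) 1 (hx i) (hy i) ha hb hab
  simpa using this

/-! ### Embedding every tree into well-spread points -/

/-- If every cell of the grid of side length `1 / q` contains at least `a` of the points `x`, then
the geometric graph contains every tree of maximum degree at most `k + 1`. Remove a small
separator from the tree, place it at the centre of the cube, choose a target cell for each
remaining piece, and let the vertices of a piece move from the centre to the target in `h` equal
steps, according to their distance to the separator. All but few vertices sit at their targets, so
the positions are distributed almost like the points `x`, and can be matched with them. -/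
theorem isContained_geometricGraph {d n q h m a k : ℕ} (hq : 0 < q) (hh : 0 < h) (hm : 0 < m)
    (hk : 2 ≤ k) {T : SimpleGraph (Fin n)} [DecidableRel T.Adj] (hT : T.IsTree)
    (hdeg : T.maxDegree ≤ k + 1) {x : Fin n → EuclideanSpace ℝ (Fin d)}
    (hx : ∀ i, x i ∈ unitCube d)
    (ha : ∀ c, a ≤ (Finset.univ.filter fun i => gridCell hq (x i) = c).card)
    (hcount : 2 * (n / m + 1) * k ^ h + q ^ d * m ≤ a) {r : ℝ}
    (hr : Real.sqrt d * (1 / (2 * h) + 4 / q) ≤ r) : T ⊑ geometricGraph x r := by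
  classical
  obtain ⟨C, π, hCne, hCcard, hπ, hpiece⟩ := hT.exists_separator hm
  obtain ⟨D, hD0, hDadj, hDpar⟩ := hT.connected.exists_level hCne
  rw [Fintype.card_fin] at hCcard
  have hDC : (Finset.univ.filter fun v => D v = 0) = C := by
    ext v; simp [hD0]
  have hnear := card_level_lt_le T hk hdeg D hDpar h
  rw [hDC] at hnear
  have : Nonempty (Fin q) := ⟨⟨0, hq⟩⟩
  -- Choose the target cells of the pieces.
  obtain ⟨f, hf⟩ := exists_assignment_le_add (κ := Fin d → Fin q) Finset.univ
    (fun y => (Finset.univ.filter fun v => v ∉ C ∧ π v = y).card)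
    (fun c => (Finset.univ.filter fun i => gridCell hq (x i) = c).card) (m := m)
    (fun y _ => hpiece y) (by
      rw [← Finset.card_eq_sum_card_fiberwise (s := Finset.univ) (t := Finset.univ)
        (fun _ _ => Finset.mem_univ _), Finset.card_univ]
      have h1 : ∀ y, (Finset.univ.filter fun v => v ∉ C ∧ π v = y).card =
          ((Finset.univ.filter fun v => v ∉ C).filter fun v => π v = y).card := by
        intro y; rw [Finset.filter_filter]
      simp_rw [h1]
      rw [← Finset.card_eq_sum_card_fiberwise (fun _ _ => Finset.mem_univ _)]
      exact Finset.card_le_univ _)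
  have hh' : (0 : ℝ) < h := by exact_mod_cast hh
  -- The positions of the tree vertices.
  set α : Fin n → ℝ := fun v => min 1 ((D v : ℝ) / h) with hα
  set pos : Fin n → EuclideanSpace ℝ (Fin d) := fun v =>
    cubeCenter d + α v • (cellCenter (f (π v)) - cubeCenter d) with hpos
  have hα0 : ∀ v, 0 ≤ α v := fun v => le_min zero_le_one (by positivity)
  have hα1 : ∀ v, α v ≤ 1 := fun v => min_le_left _ _
  have hposmem : ∀ v, pos v ∈ unitCube d := fun v =>
    (convex_unitCube d).add_smul_sub_mem (cubeCenter_mem d) (cellCenter_mem _) ⟨hα0 v, hα1 v⟩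
  have hposfar : ∀ v, h ≤ D v → gridCell hq (pos v) = f (π v) := by
    intro v hv
    have h1 : α v = 1 := by
      refine min_eq_left ?_
      rw [one_le_div hh']
      exact_mod_cast hv
    simp only [hpos, h1, one_smul, add_sub_cancel]
    exact gridCell_cellCenter hq _
  have hexcess : ∀ S : Finset (Fin d → Fin q),
      (Finset.univ.filter fun v => gridCell hq (pos v) ∈ S).card ≤
        (Finset.univ.filter fun i => gridCell hq (x i) ∈ S).card + a := by
    intro S
    have hsub : (Finset.univ.filter fun v => gridCell hq (pos v) ∈ S) ⊆
        (Finset.univ.filter fun v => D v < h) ∪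
          S.biUnion fun c => (Finset.univ.filter fun y => f y = c).biUnion fun y =>
            Finset.univ.filter fun v => v ∉ C ∧ π v = y := by
      intro v hv
      simp only [Finset.mem_filter, Finset.mem_univ, true_and] at hv
      simp only [Finset.mem_union, Finset.mem_filter, Finset.mem_univ, true_and,
        Finset.mem_biUnion]
      by_cases hvh : D v < h
      · exact Or.inl hvh
      · rw [hposfar v (by omega)] at hv
        exact Or.inr ⟨_, hv, _, rfl, fun hvC => hvh (by rw [(hD0 v).2 hvC]; exact hh), rfl⟩
    have hpts : ∑ c ∈ S, (Finset.univ.filter fun i => gridCell hq (x i) = c).card =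
        (Finset.univ.filter fun i => gridCell hq (x i) ∈ S).card := by
      rw [Finset.card_eq_sum_card_fiberwise (f := fun i => gridCell hq (x i)) (t := S)
        (fun i hi => by simpa using hi)]
      refine Finset.sum_congr rfl fun c hc => ?_
      rw [Finset.filter_filter]
      congr 1
      refine Finset.filter_congr fun i _ => ⟨fun h => ⟨h ▸ hc, h⟩, fun h => h.2⟩
    have hScard : S.card ≤ q ^ d := by
      refine (Finset.card_le_univ S).trans ?_
      simp
    calc _ ≤ _ := (Finset.card_le_card hsub).trans (Finset.card_union_le _ _)
      _ ≤ 2 * C.card * k ^ h + ∑ c ∈ S,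
            ((Finset.univ.filter fun i => gridCell hq (x i) = c).card + m) :=
          add_le_add hnear (Finset.card_biUnion_le.trans (Finset.sum_le_sum fun c _ =>
            Finset.card_biUnion_le.trans (hf c)))
      _ ≤ 2 * (n / m + 1) * k ^ h +
            ((Finset.univ.filter fun i => gridCell hq (x i) ∈ S).card + q ^ d * m) := by
          rw [Finset.sum_add_distrib, hpts, Finset.sum_const, smul_eq_mul]
          gcongr
      _ ≤ _ := by omega
  obtain ⟨σ, hσ, htouch⟩ := exists_injective_of_excess_le rfl GridTouch GridTouch.refl
    exists_gridTouch_notMem (fun v => gridCell hq (pos v)) (fun i => gridCell hq (x i)) ha hexcess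
  have hnearσ : ∀ v, dist (pos v) (x (σ v)) ≤ Real.sqrt d * (2 / q) := fun v =>
    dist_le_of_gridTouch hq (hposmem v) (hx _) (htouch v)
  -- Adjacent tree vertices are one step apart.
  have hαadj : ∀ u v, T.Adj u v → |α u - α v| ≤ 1 / h := by
    intro u v huv
    have h1 : (D u : ℝ) ≤ D v + 1 := by exact_mod_cast hDadj u v huv
    have h2 : (D v : ℝ) ≤ D u + 1 := by exact_mod_cast hDadj v u huv.symm
    have h3 : (D u : ℝ) / h ≤ D v / h + 1 / h := by rw [← add_div]; gcongr
    have h4 : (D v : ℝ) / h ≤ D u / h + 1 / h := by rw [← add_div]; gcongr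
    have h5 : (0 : ℝ) ≤ 1 / h := by positivity
    simp only [hα]
    rw [abs_le]
    rcases min_cases (1 : ℝ) ((D u : ℝ) / h) with ⟨e, _⟩ | ⟨e, _⟩ <;>
    rcases min_cases (1 : ℝ) ((D v : ℝ) / h) with ⟨e', _⟩ | ⟨e', _⟩ <;>
    rw [e, e'] <;> constructor <;> linarith
  have hstep : ∀ (β γ : ℝ) (c : Fin d → Fin q), |β - γ| ≤ 1 / h →
      dist (cubeCenter d + β • (cellCenter c - cubeCenter d))
        (cubeCenter d + γ • (cellCenter c - cubeCenter d)) ≤ Real.sqrt d * (1 / (2 * h)) := by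
    intro β γ c hβγ
    rw [dist_add_left, dist_eq_norm, ← sub_smul, norm_smul, Real.norm_eq_abs]
    calc _ ≤ 1 / (h : ℝ) * (Real.sqrt d * (1 / 2)) :=
          mul_le_mul hβγ (norm_sub_cubeCenter_le (cellCenter_mem c)) (norm_nonneg _) (by positivity)
      _ = _ := by field_simp
  have hαC : ∀ v, v ∈ C → α v = 0 := by
    intro v hv
    simp [hα, (hD0 v).2 hv]
  have hposadj : ∀ u v, T.Adj u v → dist (pos u) (pos v) ≤ Real.sqrt d * (1 / (2 * h)) := by
    intro u v huv
    have h1 := hαadj u v huv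
    simp only [hpos]
    by_cases hu : u ∈ C
    · rw [hαC u hu] at h1 ⊢
      have := hstep 0 (α v) (f (π v)) h1
      simpa using this
    · by_cases hv : v ∈ C
      · rw [hαC v hv] at h1 ⊢
        have := hstep (α u) 0 (f (π u)) h1
        simpa using this
      · rw [hπ u v huv hu hv]
        exact hstep _ _ _ h1
  refine ⟨⟨⟨σ, ?_⟩, hσ⟩⟩
  intro u v huv
  refine ⟨fun h => huv.ne (hσ h), le_trans ?_ hr⟩
  have h1 := dist_triangle4 (x (σ u)) (pos u) (pos v) (x (σ v))
  have h2 := hnearσ u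
  rw [dist_comm] at h2
  have h3 := hnearσ v
  have h4 := hposadj u v huv
  have h5 : Real.sqrt d * (1 / (2 * h) + 4 / q) =
      Real.sqrt d * (2 / q) + Real.sqrt d * (1 / (2 * h)) + Real.sqrt d * (2 / q) := by ring
  linarith

/-! ### The complete `k`-ary tree -/

/-- The parent `(j - 1) / k` of the vertex `j` in the `k`-ary tree; the root `0` is mapped to
itself. -/
def karyParent {n : ℕ} (k : ℕ) (j : Fin n) : Fin n :=
  ⟨((j : ℕ) - 1) / k, (Nat.div_le_self _ _).trans_lt (by omega)⟩

/-- The `k`-ary tree on `0, …, n - 1` filled level by level: every `j > 0` is joined to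
its parent. -/
def karyTree (n k : ℕ) : SimpleGraph (Fin n) :=
  SimpleGraph.fromRel fun i j => 0 < (j : ℕ) ∧ karyParent k j = i

theorem karyTree_adj_parent {n k : ℕ} {j : Fin n} (hj : 0 < (j : ℕ)) :
    (karyTree n k).Adj j (karyParent k j) := by
  refine (SimpleGraph.fromRel_adj _ _ _).2 ⟨?_, Or.inr ⟨hj, rfl⟩⟩
  have := Nat.div_le_self ((j : ℕ) - 1) k
  intro h
  have h' : (j : ℕ) = ((j : ℕ) - 1) / k := congrArg Fin.val h
  omega

theorem karyTree_isTree {n k : ℕ} (hn : 0 < n) : (karyTree n k).IsTree := by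
  classical
  have hreach : ∀ N : ℕ, ∀ j : Fin n, (j : ℕ) = N → (karyTree n k).Reachable j ⟨0, hn⟩ := by
    intro N
    induction N using Nat.strong_induction_on with
    | _ N ih =>
      intro j hj
      rcases Nat.eq_zero_or_pos N with h0 | h0
      · have : j = ⟨0, hn⟩ := Fin.ext (hj.trans h0)
        rw [this]
      · have hlt : ((j : ℕ) - 1) / k < N := (Nat.div_le_self _ _).trans_lt (by omega)
        exact (karyTree_adj_parent (by omega)).reachable.trans (ih _ hlt _ rfl)
  have hconn : (karyTree n k).Connected := by
    have : Nonempty (Fin n) := ⟨⟨0, hn⟩⟩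
    exact ⟨fun u v => (hreach _ u rfl).trans (hreach _ v rfl).symm⟩
  rw [SimpleGraph.isTree_iff_connected_and_card]
  refine ⟨hconn, le_antisymm ?_ hconn.card_vert_le_card_edgeSet_add_one⟩
  -- Every edge joins a vertex other than `0` to its parent.
  have hsub : (karyTree n k).edgeFinset ⊆
      (Finset.univ.erase (⟨0, hn⟩ : Fin n)).image fun j => s(j, karyParent k j) := by
    intro e
    induction e with
    | _ i j =>
      rw [SimpleGraph.mem_edgeFinset, SimpleGraph.mem_edgeSet, karyTree, SimpleGraph.fromRel_adj]
      have aux : ∀ i j : Fin n, 0 < (j : ℕ) → karyParent k j = i → s(i, j) ∈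
          (Finset.univ.erase (⟨0, hn⟩ : Fin n)).image fun j => s(j, karyParent k j) := by
        intro i j h1 h2
        refine Finset.mem_image.2 ⟨j, Finset.mem_erase.2 ⟨?_, Finset.mem_univ _⟩, ?_⟩
        · rintro rfl
          exact lt_irrefl _ h1
        · rw [Sym2.eq_swap, h2]
      rintro ⟨-, ⟨h1, h2⟩ | ⟨h1, h2⟩⟩
      · exact aux i j h1 h2
      · rw [Sym2.eq_swap]
        exact aux j i h1 h2
  have hcard := (Finset.card_le_card hsub).trans Finset.card_image_le
  rw [Finset.card_erase_of_mem (Finset.mem_univ _), Finset.card_univ, Fintype.card_fin] at hcard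
  have h1 : Nat.card (karyTree n k).edgeSet = (karyTree n k).edgeFinset.card := by
    rw [Nat.card_eq_fintype_card, SimpleGraph.edgeFinset_card]
  rw [h1, Nat.card_eq_fintype_card, Fintype.card_fin]
  omega

theorem karyTree_maxDegree_le {n k : ℕ} (hk : 0 < k) [DecidableRel (karyTree n k).Adj] :
    (karyTree n k).maxDegree ≤ k + 1 := by
  refine SimpleGraph.maxDegree_le_of_forall_degree_le _ _ fun v => ?_
  rw [← SimpleGraph.card_neighborFinset_eq_degree,
    ← Finset.card_image_of_injective _ Fin.val_injective]
  have hsub : ((karyTree n k).neighborFinset v).image Fin.val ⊆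
      insert (((v : ℕ) - 1) / k) (Finset.Icc (v * k + 1) (v * k + k)) := by
    intro j hj
    obtain ⟨j, hj', rfl⟩ := Finset.mem_image.1 hj
    rw [SimpleGraph.mem_neighborFinset, karyTree, SimpleGraph.fromRel_adj] at hj'
    rw [Finset.mem_insert, Finset.mem_Icc]
    rcases hj'.2 with ⟨h1, h2⟩ | ⟨h1, h2⟩
    · right
      replace h2 : ((j : ℕ) - 1) / k = v := congrArg Fin.val h2
      rw [Nat.div_eq_iff hk] at h2
      omega
    · exact Or.inl (congrArg Fin.val h2).symm
  refine (Finset.card_le_card hsub).trans ((Finset.card_insert_le _ _).trans ?_)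
  rw [Nat.card_Icc]
  omega

/-- Vertices below `k ^ h` have depth at most `h`. -/
theorem dist_karyTree_root_le {n k : ℕ} (hn : 0 < n) {X : Type*} [PseudoMetricSpace X]
    (f : Fin n → X) {r : ℝ} (hf : ∀ i j, (karyTree n k).Adj i j → dist (f i) (f j) ≤ r)
    (hr : 0 ≤ r) (h : ℕ) (v : Fin n) (hv : (v : ℕ) < k ^ h) :
    dist (f v) (f ⟨0, hn⟩) ≤ h * r := by
  induction h generalizing v with
  | zero =>
    have : v = ⟨0, hn⟩ := Fin.ext (by simpa using hv)
    simp [this]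
  | succ h ih =>
    have h0 : 0 ≤ (h : ℝ) * r := by positivity
    rcases Nat.eq_zero_or_pos (v : ℕ) with hv0 | hv0
    · have : v = ⟨0, hn⟩ := Fin.ext hv0
      rw [this, dist_self]
      positivity
    · have hlt : ((v : ℕ) - 1) / k < k ^ h :=
        Nat.div_lt_of_lt_mul (by rw [mul_comm, ← pow_succ]; omega)
      have h1 := dist_triangle (f v)
        (f (karyParent k v)) (f ⟨0, hn⟩)
      have h2 := hf _ _ (karyTree_adj_parent (k := k) hv0)
      have h3 := ih (karyParent k v) hlt
      push_cast
      linarith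

/-- If all cells of the grid of side length `1 / q` are occupied and the geometric graph is
universal, then `2 h` steps of length `r`, where `n ≤ k ^ h`, span the distance between two
opposite corner cells: this is the diameter of the `k`-ary tree. -/
theorem le_of_isTreeUniversal {d n q h k : ℕ} (hq : 0 < q) (hn : 0 < n)
    (hk : 0 < k) (hnk : n ≤ k ^ h) {x : Fin n → EuclideanSpace ℝ (Fin d)}
    (hx : ∀ i, x i ∈ unitCube d) (hocc : ∀ c, ∃ i, gridCell hq (x i) = c) {r : ℝ} (hr : 0 ≤ r)
    (huniv : IsTreeUniversal n (k + 1) (geometricGraph x r)) :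
    Real.sqrt d * (1 - 2 / q) ≤ 2 * h * r := by
  classical
  obtain ⟨φ⟩ := huniv (karyTree n k) (karyTree_isTree hn) (karyTree_maxDegree_le hk)
  have hbij : Function.Bijective φ := Finite.injective_iff_bijective.1 φ.injective
  have hroot : ∀ v, dist (x (φ v)) (x (φ ⟨0, hn⟩)) ≤ h * r := fun v =>
    dist_karyTree_root_le hn (fun v => x (φ v)) (fun i j hij => (φ.toHom.map_adj hij).2) hr h v
      (v.2.trans_le hnk)
  have hall : ∀ i j, dist (x i) (x j) ≤ 2 * h * r := by
    intro i j
    obtain ⟨u, rfl⟩ := hbij.2 i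
    obtain ⟨v, rfl⟩ := hbij.2 j
    have h1 := hroot u
    have h2 := hroot v
    have h3 := dist_triangle_right (x (φ u)) (x (φ v)) (x (φ ⟨0, hn⟩))
    linarith
  obtain ⟨i, hi⟩ := hocc fun _ => ⟨0, hq⟩
  obtain ⟨j, hj⟩ := hocc fun _ => ⟨q - 1, by omega⟩
  refine le_trans ?_ (hall j i)
  have hq' : (0 : ℝ) < q := by exact_mod_cast hq
  have hcoord : ∀ t, 1 - 2 / (q : ℝ) ≤ x j t - x i t := by
    intro t
    have h1 := (gridCell_bounds hq (hx i) t).2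
    have h2 := (gridCell_bounds hq (hx j) t).1
    rw [hi] at h1
    rw [hj] at h2
    simp only at h1 h2
    rw [Nat.cast_sub hq, Nat.cast_one] at h2
    rw [Nat.cast_zero] at h1
    have h3 : (q : ℝ) * (1 - 2 / q) = q - 2 := by field_simp
    nlinarith
  by_cases hneg : 1 - 2 / (q : ℝ) ≤ 0
  · exact (mul_nonpos_of_nonneg_of_nonpos (Real.sqrt_nonneg _) hneg).trans dist_nonneg
  · rw [not_le] at hneg
    rw [EuclideanSpace.dist_eq]
    apply Real.le_sqrt_of_sq_le
    rw [mul_pow, Real.sq_sqrt (Nat.cast_nonneg _)]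
    calc (d : ℝ) * (1 - 2 / q) ^ 2 = ∑ _t : Fin d, (1 - 2 / (q : ℝ)) ^ 2 := by simp
      _ ≤ _ := Finset.sum_le_sum fun t _ => by
        rw [Real.dist_eq, sq_abs]
        exact pow_le_pow_left₀ hneg.le (hcoord t) 2

/-! ### Random points fill all cells -/

theorem volume_box {d : ℕ} (a b : Fin d → ℝ) :
    (volume : Measure (EuclideanSpace ℝ (Fin d))) {x | ∀ i, x i ∈ Set.Ico (a i) (b i)} =
      ∏ i, ENNReal.ofReal (b i - a i) := by
  have h := (PiLp.volume_preserving_ofLp (Fin d)).measure_preimage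
    (s := Set.pi Set.univ fun i => Set.Ico (a i) (b i))
    (MeasurableSet.univ_pi fun _ => measurableSet_Ico).nullMeasurableSet
  rw [Real.volume_pi_Ico] at h
  rw [← h]
  congr 1
  ext x
  simp

theorem volume_unitCube (d : ℕ) :
    (volume : Measure (EuclideanSpace ℝ (Fin d))) (unitCube d) = 1 := by
  have h := (PiLp.volume_preserving_ofLp (Fin d)).measure_preimage
    (s := Set.pi Set.univ fun _ => Set.Icc (0 : ℝ) 1)
    (MeasurableSet.univ_pi fun _ => measurableSet_Icc).nullMeasurableSet
  have h2 : unitCube d = WithLp.ofLp ⁻¹' (Set.pi Set.univ fun _ : Fin d => Set.Icc (0 : ℝ) 1) := by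
    ext x; simp [unitCube, Pi.le_def, forall_and]
  rw [h2, h]
  simp [Real.volume_Icc_pi, Set.pi_univ_Icc]

theorem measurableSet_unitCube (d : ℕ) : MeasurableSet (unitCube d) := by
  have : unitCube d = ⋂ i, (fun x : EuclideanSpace ℝ (Fin d) => x i) ⁻¹' Set.Icc 0 1 := by
    ext x; simp [unitCube]
  rw [this]
  exact MeasurableSet.iInter fun i => (by fun_prop : Measurable _) measurableSet_Icc

instance isProbabilityMeasure_restrict_unitCube (d : ℕ) : IsProbabilityMeasure
    ((volume : Measure (EuclideanSpace ℝ (Fin d))).restrict (unitCube d)) :=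
  ⟨by rw [Measure.restrict_apply_univ, volume_unitCube]⟩

instance isProbabilityMeasure_uniformPoints (d n : ℕ) :
    IsProbabilityMeasure (uniformPoints d n) := by
  unfold uniformPoints; infer_instance

/-- The half-open box underlying a grid cell. -/
def gridBox {d q : ℕ} (c : Fin d → Fin q) : Set (EuclideanSpace ℝ (Fin d)) :=
  {x | ∀ i, x i ∈ Set.Ico (((c i : ℕ) : ℝ) / q) ((((c i : ℕ) : ℝ) + 1) / q)}

theorem measurableSet_gridBox {d q : ℕ} (c : Fin d → Fin q) : MeasurableSet (gridBox c) := by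
  have : gridBox c = ⋂ i, (fun x : EuclideanSpace ℝ (Fin d) => x i) ⁻¹'
      Set.Ico (((c i : ℕ) : ℝ) / q) ((((c i : ℕ) : ℝ) + 1) / q) := by
    ext x; simp [gridBox]
  rw [this]
  exact MeasurableSet.iInter fun i => (by fun_prop : Measurable _) measurableSet_Ico

theorem gridBox_subset_unitCube {d q : ℕ} (c : Fin d → Fin q) : gridBox c ⊆ unitCube d := by
  intro x hx i
  have hq : (0 : ℝ) < q := by exact_mod_cast (c i).pos
  have hlt : ((c i : ℕ) : ℝ) + 1 ≤ q := by exact_mod_cast (c i).2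
  exact ⟨(by positivity : (0 : ℝ) ≤ ((c i : ℕ) : ℝ) / q).trans (hx i).1,
    (hx i).2.le.trans ((div_le_one hq).2 hlt)⟩

theorem gridCell_eq_of_mem_gridBox {d q : ℕ} (hq : 0 < q) {c : Fin d → Fin q}
    {x : EuclideanSpace ℝ (Fin d)} (hx : x ∈ gridBox c) : gridCell hq x = c := by
  have hq' : (0 : ℝ) < q := by exact_mod_cast hq
  refine gridCell_eq_of_mem hq fun i => ?_
  rw [mul_comm, ← div_le_iff₀ hq', ← lt_div_iff₀ hq']
  exact hx i

theorem restrict_gridBox_compl {d q : ℕ} (hq : 0 < q) (c : Fin d → Fin q) :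
    (volume : Measure (EuclideanSpace ℝ (Fin d))).restrict (unitCube d) (gridBox c)ᶜ =
      ENNReal.ofReal (1 - 1 / (q : ℝ) ^ d) := by
  have hq' : (0 : ℝ) < q := by exact_mod_cast hq
  rw [prob_compl_eq_one_sub (measurableSet_gridBox c),
    Measure.restrict_eq_self _ (gridBox_subset_unitCube c), gridBox, volume_box]
  have h1 : ∀ i, (((c i : ℕ) : ℝ) + 1) / q - ((c i : ℕ) : ℝ) / q = 1 / q := by
    intro i; ring
  simp_rw [h1]
  rw [Finset.prod_const, Finset.card_univ, Fintype.card_fin,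
    ← ENNReal.ofReal_pow (by positivity), ← ENNReal.ofReal_one,
    ← ENNReal.ofReal_sub _ (by positivity)]
  congr 2
  rw [div_pow, one_pow]

/-- The probability that none of the points with index in `B` lies in a given cell. -/
theorem uniformPoints_forall_notMem_gridBox {d n q : ℕ} (hq : 0 < q) (c : Fin d → Fin q)
    (B : Finset (Fin n)) :
    uniformPoints d n {x | ∀ i ∈ B, x i ∉ gridBox c} =
      ENNReal.ofReal (1 - 1 / (q : ℝ) ^ d) ^ B.card := by
  classical
  have h : {x : Fin n → EuclideanSpace ℝ (Fin d) | ∀ i ∈ B, x i ∉ gridBox c} =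
      Set.pi Set.univ fun i => if i ∈ B then (gridBox c)ᶜ else Set.univ := by
    ext x
    simp only [Set.mem_ofPred_eq, Set.mem_pi, Set.mem_univ, true_implies]
    refine forall_congr' fun i => ?_
    by_cases hi : i ∈ B <;> simp [hi]
  rw [h, uniformPoints, Measure.pi_pi]
  have h2 : ∀ i, (volume : Measure (EuclideanSpace ℝ (Fin d))).restrict (unitCube d)
      (if i ∈ B then (gridBox c)ᶜ else Set.univ) =
      if i ∈ B then ENNReal.ofReal (1 - 1 / (q : ℝ) ^ d) else 1 := by
    intro i
    split_ifs
    · exact restrict_gridBox_compl hq c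
    · exact measure_univ
  simp_rw [h2]
  rw [Finset.prod_ite_mem, Finset.univ_inter, Finset.prod_const]

theorem ae_mem_unitCube (d n : ℕ) : ∀ᵐ x ∂(uniformPoints d n), ∀ i, x i ∈ unitCube d := by
  rw [ae_all_iff]
  intro i
  have h : ∀ᵐ y ∂((volume : Measure (EuclideanSpace ℝ (Fin d))).restrict (unitCube d)),
      y ∈ unitCube d := ae_restrict_mem (measurableSet_unitCube d)
  exact (measurePreserving_eval
    (fun _ : Fin n => (volume : Measure (EuclideanSpace ℝ (Fin d))).restrict (unitCube d))
    i).quasiMeasurePreserving.ae h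

/-- With probability close to one, each grid cell contains at least `a` of the `n` points. Split the
indices into `a` blocks of length `b`; the bound is the expected number of pairs of a cell and a
block that has no point in this cell. -/
theorem uniformPoints_exists_sparse_cell_le {d n q a b : ℕ} (hq : 0 < q) (hb : 0 < b)
    (hab : a * b ≤ n) :
    uniformPoints d n {x | ¬ ((∀ i, x i ∈ unitCube d) ∧
      ∀ c, a ≤ (Finset.univ.filter fun i => gridCell hq (x i) = c).card)} ≤
      ENNReal.ofReal (q ^ d * a * (1 - 1 / (q : ℝ) ^ d) ^ b) := by
  classical
  let B : ℕ → Finset (Fin n) := fun t => Finset.univ.filter fun i => (i : ℕ) / b = t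
  have hBcard : ∀ t, t < a → (B t).card = b := by
    intro t ht
    have hlt : ∀ s, s < b → t * b + s < n := by
      intro s hs
      have : (t + 1) * b ≤ a * b := Nat.mul_le_mul_right _ ht
      rw [add_mul, one_mul] at this
      omega
    rw [← Finset.card_image_of_injective _ Fin.val_injective]
    have : (B t).image Fin.val = Finset.Ico (t * b) (t * b + b) := by
      ext j
      simp only [B, Finset.mem_image, Finset.mem_filter, Finset.mem_univ, true_and,
        Finset.mem_Ico]
      constructor
      · rintro ⟨i, hi, rfl⟩
        rw [Nat.div_eq_iff hb] at hi
        omega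
      · rintro ⟨h1, h2⟩
        have := hlt (j - t * b) (by omega)
        refine ⟨⟨j, by omega⟩, ?_, rfl⟩
        rw [Nat.div_eq_iff hb]
        simp only
        omega
    rw [this]
    simp
  have hsub : {x | ¬ ((∀ i, x i ∈ unitCube d) ∧
      ∀ c, a ≤ (Finset.univ.filter fun i => gridCell hq (x i) = c).card)} ⊆
      {x : Fin n → EuclideanSpace ℝ (Fin d) | ¬ ∀ i, x i ∈ unitCube d} ∪
        ⋃ ct ∈ (Finset.univ : Finset (Fin d → Fin q)) ×ˢ Finset.range a,
          {x | ∀ i ∈ B ct.2, x i ∉ gridBox ct.1} := by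
    intro x hx
    by_contra hcon
    simp only [Set.mem_union, Set.mem_ofPred_eq, Set.mem_iUnion, not_or, not_not, Finset.mem_product,
      Finset.mem_univ, true_and, Finset.mem_range, not_exists, not_forall, exists_prop] at hcon
    obtain ⟨hcube, hhit⟩ := hcon
    refine hx ⟨hcube, fun c => ?_⟩
    have hblock : ∀ t, t < a → ∃ i ∈ B t, x i ∈ gridBox c := by
      intro t ht
      by_contra! h
      exact hhit (c, t) ⟨ht, h⟩
    rcases Nat.eq_zero_or_pos a with ha | ha
    · exact ha ▸ Nat.zero_le _
    have : Nonempty (Fin n) := ⟨(hblock 0 ha).choose⟩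
    choose! g hg1 hg2 using hblock
    calc a = (Finset.range a).card := (Finset.card_range a).symm
      _ ≤ _ := Finset.card_le_card_of_injOn g (fun t ht => ?_) ?_
    · rw [Finset.coe_filter]
      exact ⟨Finset.mem_univ _, gridCell_eq_of_mem_gridBox hq (hg2 t (by simpa using ht))⟩
    · intro s hs t ht hst
      have h1 := (Finset.mem_filter.1 (hg1 s (by simpa using hs))).2
      have h2 := (Finset.mem_filter.1 (hg1 t (by simpa using ht))).2
      rw [← h1, ← h2, hst]
  have hp : (0 : ℝ) ≤ 1 - 1 / (q : ℝ) ^ d := by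
    have : (1 : ℝ) ≤ (q : ℝ) ^ d := one_le_pow₀ (by exact_mod_cast hq)
    rw [sub_nonneg]
    exact div_le_one_of_le₀ this (by positivity)
  calc _ ≤ _ := measure_mono hsub
    _ ≤ 0 + ∑ ct ∈ (Finset.univ : Finset (Fin d → Fin q)) ×ˢ Finset.range a,
          uniformPoints d n {x | ∀ i ∈ B ct.2, x i ∉ gridBox ct.1} := by
        refine (measure_union_le _ _).trans (add_le_add (le_of_eq ?_)
          (measure_biUnion_finset_le _ _))
        exact ae_iff.1 (ae_mem_unitCube d n)
    _ = ∑ _ct ∈ (Finset.univ : Finset (Fin d → Fin q)) ×ˢ Finset.range a,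
          ENNReal.ofReal (1 - 1 / (q : ℝ) ^ d) ^ b := by
        rw [zero_add]
        refine Finset.sum_congr rfl fun ct hct => ?_
        rw [uniformPoints_forall_notMem_gridBox hq,
          hBcard _ (Finset.mem_range.1 (Finset.mem_product.1 hct).2)]
    _ = _ := by
        rw [Finset.sum_const, Finset.card_product, Finset.card_univ, Finset.card_range,
          Fintype.card_fun, Fintype.card_fin, Fintype.card_fin, nsmul_eq_mul,
          ENNReal.ofReal_mul (by positivity), ENNReal.ofReal_pow hp]
        congr 1
        rw [← Nat.cast_pow, ← Nat.cast_mul, ENNReal.ofReal_natCast]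

/-! ### Choice of parameters -/

/-- The number of grid cells per side. Both bounds need the mesh to be at most a small constant times
`(1 / log n) ^ 2`, and the number of cells to be polynomial in `log n`. -/
noncomputable def gridSize (n : ℕ) : ℕ := ⌈5 * Real.log n ^ 2⌉₊

/-- The length of the blocks of points used to bound the number of points in a cell from below:
a block misses a given cell with probability at most `n ^ (-3)`. -/
noncomputable def blockLength (d n : ℕ) : ℕ := ⌈3 * (gridSize n : ℝ) ^ d * Real.log n⌉₊

/-- The event that the points lie in the unit cube and every cell of the grid contains at least
`n / blockLength d n` of them. -/
def wellSpread (d n : ℕ) : Set (Fin n → EuclideanSpace ℝ (Fin d)) :=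
  {x | (∀ i, x i ∈ unitCube d) ∧ ∀ (hq : 0 < gridSize n) (c : Fin d → Fin (gridSize n)),
    n / blockLength d n ≤ (Finset.univ.filter fun i => gridCell hq (x i) = c).card}

theorem gridSize_pos {n : ℕ} (hn : 0 < Real.log n) : 0 < gridSize n :=
  Nat.ceil_pos.2 (by positivity)

theorem tendsto_log_natCast : Tendsto (fun n : ℕ => Real.log n) atTop atTop :=
  Real.tendsto_log_atTop.comp tendsto_natCast_atTop_atTop

theorem uniformPoints_compl_wellSpread_le {d n : ℕ} (hn : 1 ≤ Real.log n) :
    uniformPoints d n (wellSpread d n)ᶜ ≤ ENNReal.ofReal ((n : ℝ)⁻¹) := by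
  have hn0 : (0 : ℝ) < n := by
    rcases Nat.eq_zero_or_pos n with rfl | h
    · norm_num at hn
    · exact_mod_cast h
  have hq := gridSize_pos (zero_lt_one.trans_le hn)
  have hM : (0 : ℝ) < (gridSize n : ℝ) ^ d := by
    have : (0 : ℝ) < gridSize n := by exact_mod_cast hq
    positivity
  have hb : 3 * (gridSize n : ℝ) ^ d * Real.log n ≤ blockLength d n := Nat.le_ceil _
  have hMb : (gridSize n : ℝ) ^ d ≤ blockLength d n := by nlinarith
  have hb0 : 0 < blockLength d n := by
    have : (0 : ℝ) < blockLength d n := hM.trans_le hMb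
    exact_mod_cast this
  have hset : (wellSpread d n)ᶜ = {x | ¬ ((∀ i, x i ∈ unitCube d) ∧
      ∀ c, n / blockLength d n ≤ (Finset.univ.filter fun i => gridCell hq (x i) = c).card)} := by
    ext x
    simp only [wellSpread, Set.mem_compl_iff, Set.mem_ofPred_eq]
    exact not_congr (and_congr_right fun _ => ⟨fun h => h hq, fun h _ => h⟩)
  rw [hset]
  refine (uniformPoints_exists_sparse_cell_le hq hb0 (Nat.div_mul_le_self _ _)).trans
    (ENNReal.ofReal_le_ofReal ?_)
  have h1 : (gridSize n : ℝ) ^ d * ((n / blockLength d n : ℕ) : ℝ) ≤ n := by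
    have : ((n / blockLength d n : ℕ) : ℝ) * blockLength d n ≤ n := by
      exact_mod_cast Nat.div_mul_le_self _ _
    have h0 : (0 : ℝ) ≤ ((n / blockLength d n : ℕ) : ℝ) := Nat.cast_nonneg _
    nlinarith
  have h2 : 1 - 1 / (gridSize n : ℝ) ^ d ≤ Real.exp (-(1 / (gridSize n : ℝ) ^ d)) := by
    have := Real.add_one_le_exp (-(1 / (gridSize n : ℝ) ^ d))
    linarith
  have h3 : 0 ≤ 1 - 1 / (gridSize n : ℝ) ^ d := by
    rw [sub_nonneg]
    exact div_le_one_of_le₀ (one_le_pow₀ (by exact_mod_cast hq)) hM.le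
  have h4 : (1 - 1 / (gridSize n : ℝ) ^ d) ^ blockLength d n ≤ ((n : ℝ) ^ 3)⁻¹ := by
    calc _ ≤ Real.exp (-(1 / (gridSize n : ℝ) ^ d)) ^ blockLength d n := pow_le_pow_left₀ h3 h2 _
      _ = Real.exp (-(blockLength d n / (gridSize n : ℝ) ^ d)) := by
        rw [← Real.exp_nat_mul]; congr 1; ring
      _ ≤ Real.exp (-(3 * Real.log n)) := by
        rw [Real.exp_le_exp, neg_le_neg_iff, le_div_iff₀ hM]
        linarith
      _ = _ := by
        rw [Real.exp_neg, mul_comm, Real.exp_mul, Real.exp_log hn0]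
        norm_cast
  have hn1 : (1 : ℝ) ≤ n := by
    have : 0 < n := by exact_mod_cast hn0
    exact_mod_cast this
  calc _ ≤ (n : ℝ) * ((n : ℝ) ^ 3)⁻¹ := mul_le_mul h1 h4 (pow_nonneg h3 _) hn0.le
    _ = (n : ℝ)⁻¹ * (n : ℝ)⁻¹ := by field_simp
    _ ≤ (n : ℝ)⁻¹ * 1 := by gcongr; exact inv_le_one_of_one_le₀ hn1
    _ = _ := mul_one _

theorem tendsto_uniformPoints_compl_wellSpread (d : ℕ) :
    Tendsto (fun n => uniformPoints d n (wellSpread d n)ᶜ) atTop (𝓝 0) := by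
  have h : Tendsto (fun n : ℕ => ENNReal.ofReal ((n : ℝ)⁻¹)) atTop (𝓝 0) := by
    rw [← ENNReal.ofReal_zero]
    exact ENNReal.tendsto_ofReal tendsto_inv_atTop_nhds_zero_nat
  refine tendsto_of_tendsto_of_tendsto_of_le_of_le' tendsto_const_nhds h
    (Eventually.of_forall fun _ => zero_le) ?_
  filter_upwards [tendsto_log_natCast.eventually_ge_atTop 1] with n hn
  exact uniformPoints_compl_wellSpread_le hn

theorem tendsto_rggProb_zero {d : ℕ} {r : ℕ → ℝ} {P : (n : ℕ) → SimpleGraph (Fin n) → Prop}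
    (h : ∀ᶠ n in atTop, ∀ x ∈ wellSpread d n, ¬ P n (geometricGraph x (r n))) :
    Tendsto (fun n => rggProb d n (r n) (P n)) atTop (𝓝 0) := by
  refine tendsto_of_tendsto_of_tendsto_of_le_of_le' tendsto_const_nhds
    (tendsto_uniformPoints_compl_wellSpread d) (Eventually.of_forall fun _ => zero_le) ?_
  filter_upwards [h] with n hn
  exact measure_mono fun x hx hw => hn x hw hx

theorem tendsto_rggProb_one {d : ℕ} {r : ℕ → ℝ} {P : (n : ℕ) → SimpleGraph (Fin n) → Prop}
    (h : ∀ᶠ n in atTop, ∀ x ∈ wellSpread d n, P n (geometricGraph x (r n))) :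
    Tendsto (fun n => rggProb d n (r n) (P n)) atTop (𝓝 1) := by
  have hlim : Tendsto (fun n => 1 - uniformPoints d n (wellSpread d n)ᶜ) atTop (𝓝 1) := by
    have := ENNReal.Tendsto.sub (tendsto_const_nhds (x := (1 : ENNReal)))
      (tendsto_uniformPoints_compl_wellSpread d) (Or.inl ENNReal.one_ne_top)
    simpa using this
  refine tendsto_of_tendsto_of_tendsto_of_le_of_le' hlim tendsto_const_nhds ?_
    (Eventually.of_forall fun _ => prob_le_one)
  filter_upwards [h] with n hn
  rw [tsub_le_iff_right]
  calc (1 : ENNReal) = uniformPoints d n Set.univ := measure_univ.symm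
    _ ≤ uniformPoints d n ({x | P n (geometricGraph x (r n))} ∪ (wellSpread d n)ᶜ) := by
        refine measure_mono fun x _ => ?_
        by_cases hx : x ∈ wellSpread d n
        · exact Or.inl (hn x hx)
        · exact Or.inr hx
    _ ≤ _ := measure_union_le _ _

theorem geometricGraph_mono {d n : ℕ} (x : Fin n → EuclideanSpace ℝ (Fin d)) {r s : ℝ}
    (h : r ≤ s) : geometricGraph x r ≤ geometricGraph x s :=
  fun _ _ hij => ⟨hij.1, hij.2.trans h⟩

theorem IsTreeUniversal.mono {n Δ : ℕ} {V : Type*} {G H : SimpleGraph V} (hGH : G ≤ H)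
    (hG : IsTreeUniversal n Δ G) : IsTreeUniversal n Δ H :=
  fun T _ hT hdeg => (hG T hT hdeg).mono_right hGH

theorem gridSize_bounds {n : ℕ} (hn : 6 ≤ Real.log n) :
    5 * Real.log n ^ 2 ≤ gridSize n ∧ (gridSize n : ℝ) ≤ Real.log n ^ 3 := by
  refine ⟨Nat.le_ceil _, ?_⟩
  have := (Nat.ceil_lt_add_one (by positivity : 0 ≤ 5 * Real.log n ^ 2)).le
  refine le_trans this ?_
  nlinarith [mul_nonneg (sub_nonneg.2 hn) (sq_nonneg (Real.log n))]

/-! ### The lower bound -/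

/-- Below the lower radius, well-spread points do not even span the `k`-ary tree, whose depth is
at most `log n / log k + 1`. -/
theorem not_isTreeUniversal_of_le {d n k : ℕ} (hd : 1 ≤ d) (hk : 2 ≤ k) (hn : 6 ≤ Real.log n)
    (hkn : Real.log k / Real.log n ≤ 1) (ha : 0 < n / blockLength d n)
    {x : Fin n → EuclideanSpace ℝ (Fin d)} (hx : x ∈ wellSpread d n) {r : ℝ}
    (hr : r ≤ (1 - Real.log k / Real.log n) * (Real.sqrt d * Real.log k / (2 * Real.log n))) :
    ¬ IsTreeUniversal n (k + 1) (geometricGraph x r) := by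
  intro huniv
  have hl : (0 : ℝ) < Real.log n := by linarith
  have hn0 : 0 < n := by
    rcases Nat.eq_zero_or_pos n with rfl | h
    · norm_num at hn
    · exact h
  have hk2 : (2 : ℝ) ≤ k := by exact_mod_cast hk
  have hL2 : Real.log 2 ≤ Real.log k := Real.log_le_log (by norm_num) hk2
  have hL : 0.69 < Real.log k := by have := Real.log_two_gt_d9; linarith
  have hL0 : 0 < Real.log k := by linarith
  have hq := gridSize_pos hl
  set y := Real.log k / Real.log n with hy
  have hy0 : 0 < y := by positivity
  set r₀ := (1 - y) * (Real.sqrt d * Real.log k / (2 * Real.log n)) with hr₀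
  have hr₀0 : 0 ≤ r₀ := mul_nonneg (by linarith) (by positivity)
  set h := ⌈Real.log n / Real.log k⌉₊ with hh
  have hh1 : Real.log n / Real.log k ≤ h := Nat.le_ceil _
  have hh2 : (h : ℝ) < Real.log n / Real.log k + 1 := Nat.ceil_lt_add_one (by positivity)
  have hnk : n ≤ k ^ h := by
    have h1 : Real.log n ≤ Real.log ((k : ℝ) ^ h) := by
      rw [Real.log_pow]
      exact (div_le_iff₀ hL0).1 hh1
    have h2 := (Real.log_le_log_iff (by exact_mod_cast hn0) (by positivity)).1 h1
    exact_mod_cast h2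
  have hmain := le_of_isTreeUniversal hq hn0 (by omega) hnk hx.1 (fun c => by
    have := ha.trans_le (hx.2 hq c)
    obtain ⟨i, hi⟩ := Finset.card_pos.1 this
    exact ⟨i, (Finset.mem_filter.1 hi).2⟩) hr₀0 (huniv.mono (geometricGraph_mono x hr))
  -- The tree has diameter at most `2 h ≤ 2 (1 + y) / y`, so `2 h r₀ ≤ √d (1 - y ^ 2)`.
  have hbound : 2 * h * r₀ ≤ Real.sqrt d * (1 - y ^ 2) := by
    have e : Real.sqrt d * (1 - y ^ 2) = 2 * (Real.log n / Real.log k + 1) * r₀ := by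
      simp only [hr₀, hy]
      field_simp
      ring
    rw [e]
    gcongr
  have hsd : 0 < Real.sqrt d := Real.sqrt_pos.2 (by exact_mod_cast hd)
  have h1 : 1 - 2 / (gridSize n : ℝ) ≤ 1 - y ^ 2 :=
    le_of_mul_le_mul_left (hmain.trans hbound) hsd
  have h2 : 2 / (gridSize n : ℝ) ≤ 2 / (5 * Real.log n ^ 2) := by
    gcongr
    exact (gridSize_bounds hn).1
  have h3 : y ^ 2 ≤ 2 / (5 * Real.log n ^ 2) := by linarith
  rw [hy, div_pow, div_le_div_iff₀ (by positivity) (by positivity)] at h3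
  have h4 : (0.69 : ℝ) ^ 2 < Real.log k ^ 2 := pow_lt_pow_left₀ hL (by norm_num) (by norm_num)
  have h5 : 0 < Real.log n ^ 2 := by positivity
  nlinarith

/-! ### The upper bound -/

/-- The counting condition of the embedding. Here `Y` is a bound for powers of `Δ log n`, the
number `M` of cells is at most `Y ^ 3`, the pieces have at most `m ≈ n / Y ^ 9` vertices, and at
most `2 n / Y ^ 16` vertices per separator vertex lie within distance `h` of the separator. -/
theorem count_le {n M k h : ℕ} {Y l : ℝ} (hY : 18 ≤ Y) (hM1 : 1 ≤ M) (hM : (M : ℝ) ≤ Y ^ 3)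
    (hl : 1 ≤ l) (hlY : 3 * l ≤ Y) (hn : Y ^ 34 ≤ n) (hkh : (k : ℝ) ^ h ≤ n / Y ^ 16) :
    0 < ⌊(n : ℝ) / Y ^ 9⌋₊ ∧ 0 < n / ⌈3 * (M : ℝ) * l⌉₊ ∧
      2 * (n / ⌊(n : ℝ) / Y ^ 9⌋₊ + 1) * k ^ h + M * ⌊(n : ℝ) / Y ^ 9⌋₊ ≤
        n / ⌈3 * (M : ℝ) * l⌉₊ := by
  have hY0 : 0 < Y := by linarith
  have hY1 : 1 ≤ Y := by linarith
  have hn0 : (0 : ℝ) < n := (by positivity : 0 < Y ^ 34).trans_le hn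
  have hM1' : (1 : ℝ) ≤ M := by exact_mod_cast hM1
  set m := ⌊(n : ℝ) / Y ^ 9⌋₊ with hm
  set b := ⌈3 * (M : ℝ) * l⌉₊ with hb
  have hbig : ∀ i : ℕ, i ≤ 32 → Y ^ 2 ≤ n / Y ^ i := by
    intro i hi
    rw [le_div_iff₀ (by positivity), ← pow_add]
    exact (pow_le_pow_right₀ hY1 (by omega)).trans hn
  -- `n / b ≥ n / Y ^ 5`
  have hbpos : (0 : ℝ) < b := (by positivity : 0 < 3 * (M : ℝ) * l).trans_le (Nat.le_ceil _)
  have hbY : (b : ℝ) * 2 ≤ Y ^ 5 := by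
    have h1 : (b : ℝ) ≤ 3 * M * l + 1 := (Nat.ceil_lt_add_one (by positivity)).le
    have h2 : (M : ℝ) * l ≤ Y ^ 3 * Y := by
      refine mul_le_mul hM (by linarith) (by linarith) (by positivity)
    have h3 : (1 : ℝ) ≤ M * l := by nlinarith
    have h4 : Y ^ 3 * Y * 18 ≤ Y ^ 3 * Y * Y := by gcongr
    have h5 : Y ^ 5 = Y ^ 3 * Y * Y := by ring
    nlinarith
  have ha : n / Y ^ 5 ≤ ((n / b : ℕ) : ℝ) := by
    have h1 : (n : ℝ) / b < ((n / b : ℕ) : ℝ) + 1 := by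
      have := Nat.lt_floor_add_one ((n : ℝ) / b)
      rwa [Nat.floor_div_eq_div] at this
    have h2 : (n : ℝ) / Y ^ 5 * 2 ≤ n / b := by
      rw [div_mul_eq_mul_div, div_le_div_iff₀ (by positivity) hbpos]
      nlinarith
    have h3 := hbig 5 (by norm_num)
    nlinarith
  -- `m ≥ n / Y ^ 10`
  have hm1 : (m : ℝ) ≤ n / Y ^ 9 := Nat.floor_le (by positivity)
  have hm2 : n / Y ^ 10 ≤ (m : ℝ) := by
    have h1 : (n : ℝ) / Y ^ 9 < m + 1 := Nat.lt_floor_add_one _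
    have h2 : (n : ℝ) / Y ^ 9 = n / Y ^ 10 * Y := by field_simp
    have h3 := hbig 10 (by norm_num)
    nlinarith
  have hm0 : (0 : ℝ) < m := (by positivity : 0 < n / Y ^ 10).trans_le hm2
  refine ⟨by exact_mod_cast hm0, ?_, ?_⟩
  · have : (0 : ℝ) < ((n / b : ℕ) : ℝ) := (by positivity : 0 < n / Y ^ 5).trans_le ha
    exact_mod_cast this
  have hpieces : ((n / m : ℕ) : ℝ) ≤ Y ^ 10 := by
    refine Nat.cast_div_le.trans ?_
    rw [div_le_iff₀ hm0]
    rw [div_le_iff₀ (by positivity)] at hm2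
    linarith
  have hgoal : 2 * (((n / m : ℕ) : ℝ) + 1) * (k : ℝ) ^ h + M * m ≤ ((n / b : ℕ) : ℝ) := by
    refine le_trans ?_ ha
    have h1 : (M : ℝ) * m ≤ Y ^ 3 * (n / Y ^ 9) := mul_le_mul hM hm1 hm0.le (by positivity)
    have h2 : 2 * (((n / m : ℕ) : ℝ) + 1) * (k : ℝ) ^ h ≤ 4 * Y ^ 10 * (n / Y ^ 16) := by
      refine mul_le_mul ?_ hkh (by positivity) (by positivity)
      have : 1 ≤ Y ^ 10 := one_le_pow₀ hY1
      linarith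
    have h3 : Y ^ 3 * (n / Y ^ 9) = n / Y ^ 6 := by field_simp
    have h4 : 4 * Y ^ 10 * (n / Y ^ 16) = 4 * (n / Y ^ 6) := by field_simp
    have h5 : (n : ℝ) / Y ^ 5 = n / Y ^ 6 * Y := by field_simp
    have h6 : 0 < (n : ℝ) / Y ^ 6 := by positivity
    nlinarith
  exact_mod_cast hgoal

/-- Above the upper radius, well-spread points span every tree of maximum degree at most `k + 1`: the
parameters `Y = (Δ log n) ^ d`, `m ≈ n / Y ^ 9` and `h ≈ (log n - 16 log Y) / log k` satisfy the
hypotheses of `isContained_geometricGraph`. The first part of the conclusion says that a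
well-spread family of points meets every cell. -/
theorem isTreeUniversal_of_le {d n k : ℕ} (hd : 1 ≤ d) (hk : 2 ≤ k) (hn : 6 ≤ Real.log n)
    (hkn : 34 * d * Real.log (((k : ℝ) + 1) * Real.log n) ≤ Real.log n)
    {x : Fin n → EuclideanSpace ℝ (Fin d)} (hx : x ∈ wellSpread d n) {r : ℝ}
    (hr : (1 + 100 * (d : ℝ) * Real.log (((k : ℝ) + 1) * Real.log n) / Real.log n) *
      (Real.sqrt d * Real.log k / (2 * Real.log n)) ≤ r) :
    0 < n / blockLength d n ∧ IsTreeUniversal n (k + 1) (geometricGraph x r) := by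
  set l := Real.log n with hl
  have hl0 : 0 < l := by linarith
  have hn0 : (0 : ℝ) < n := by
    rcases Nat.eq_zero_or_pos n with rfl | h
    · norm_num [hl] at hn
    · exact_mod_cast h
  have hk2 : (2 : ℝ) ≤ k := by exact_mod_cast hk
  set lam := ((k : ℝ) + 1) * l with hlam
  have hlam18 : 18 ≤ lam := by nlinarith
  have hlaml : 3 * l ≤ lam := by nlinarith
  have hklam : (k : ℝ) ≤ lam := by nlinarith
  set Y := lam ^ d with hY
  have hlamY : lam ≤ Y := le_self_pow₀ (by linarith) (by omega)
  have hY18 : 18 ≤ Y := hlam18.trans hlamY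
  have hY0 : 0 < Y := by linarith
  set g := Real.log Y with hg
  have hgd : g = d * Real.log lam := by rw [hg, hY, Real.log_pow]
  have hg1 : 1 ≤ g := by
    rw [hg, Real.le_log_iff_exp_le hY0]
    have := Real.exp_one_lt_d9
    linarith
  have hgl : 34 * g ≤ l := by rw [hgd]; linarith
  set L := Real.log k with hL
  have hLhalf : 1 / 2 < L := by
    have h1 : Real.log 2 ≤ L := Real.log_le_log (by norm_num) hk2
    have := Real.log_two_gt_d9
    linarith
  have hL0 : 0 < L := by linarith
  have hLg : L ≤ g := Real.log_le_log (by linarith) (hklam.trans hlamY)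
  have hq : 0 < gridSize n := gridSize_pos hl0
  obtain ⟨hq1, hq2⟩ := gridSize_bounds hn
  rw [← hl] at hq1 hq2
  set h := ⌊(l - 16 * g) / L⌋₊ with hh
  have hfrac : 0 ≤ (l - 16 * g) / L := div_nonneg (by linarith) hL0.le
  have hh1 : h * L ≤ l - 16 * g := (le_div_iff₀ hL0).1 (Nat.floor_le hfrac)
  have hh2 : l - 17 * g < h * L := by
    have h1 : (l - 16 * g) / L < h + 1 := Nat.lt_floor_add_one _
    rw [div_lt_iff₀ hL0] at h1
    linarith
  have hh0 : (0 : ℝ) < h := by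
    by_contra hcon
    have : (h : ℝ) * L ≤ 0 := mul_nonpos_of_nonpos_of_nonneg (not_lt.1 hcon) hL0.le
    linarith
  have hexpg : ∀ i : ℕ, Y ^ i = Real.exp (i * g) := by
    intro i
    rw [Real.exp_nat_mul, hg, Real.exp_log hY0]
  have hnexp : (n : ℝ) = Real.exp l := (Real.exp_log hn0).symm
  obtain ⟨hm, hb, hcount⟩ := count_le (n := n) (M := gridSize n ^ d) (k := k) (h := h) hY18
    (Nat.one_le_pow _ _ hq) (by
      push_cast
      rw [hY, ← pow_mul, mul_comm d 3, pow_mul]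
      refine pow_le_pow_left₀ (Nat.cast_nonneg _) (hq2.trans ?_) d
      exact pow_le_pow_left₀ hl0.le (by linarith) 3)
    (by linarith : 1 ≤ l) (hlaml.trans hlamY) (by
      rw [hexpg, hnexp, Real.exp_le_exp]
      push_cast
      exact hgl) (by
      rw [hexpg, hnexp, ← Real.exp_sub, ← Real.exp_log (by linarith : (0 : ℝ) < k), ← hL,
        ← Real.exp_nat_mul, Real.exp_le_exp]
      push_cast
      exact hh1)
  rw [Nat.cast_pow] at hcount hb
  refine ⟨hb, ?_⟩
  intro T _ hT hdeg
  refine isContained_geometricGraph hq (by exact_mod_cast hh0) hm hk hT hdeg hx.1 (hx.2 hq) hcount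
    (le_trans ?_ hr)
  have e : (1 + 100 * (d : ℝ) * Real.log lam / l) * (Real.sqrt d * L / (2 * l)) =
      Real.sqrt d * ((1 + 100 * g / l) * (L / (2 * l))) := by
    rw [hgd]; ring
  rw [e]
  refine mul_le_mul_of_nonneg_left ?_ (Real.sqrt_nonneg _)
  -- `h L ≥ l - 17 g` and `1 / (1 - 17 g / l) ≤ 1 + 34 g / l`
  have h1 : 1 / (2 * (h : ℝ)) ≤ (1 + 34 * g / l) * (L / (2 * l)) := by
    have e2 : (1 + 34 * g / l) * (L / (2 * l)) = (l + 34 * g) * L / (2 * l ^ 2) := by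
      field_simp
    rw [e2, div_le_div_iff₀ (by positivity) (by positivity)]
    have h2 : l ^ 2 ≤ (l + 34 * g) * (l - 17 * g) := by nlinarith
    have h3 : (l + 34 * g) * (l - 17 * g) ≤ (l + 34 * g) * (h * L) :=
      mul_le_mul_of_nonneg_left hh2.le (by linarith)
    nlinarith
  have h2 : 4 / (gridSize n : ℝ) ≤ 66 * g / l * (L / (2 * l)) := by
    calc 4 / (gridSize n : ℝ) ≤ 4 / (5 * l ^ 2) := by gcongr
      _ ≤ 33 * (1 * (1 / 2)) / l ^ 2 := by
        rw [div_le_div_iff₀ (by positivity) (by positivity)]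
        nlinarith [sq_nonneg l]
      _ ≤ 33 * (g * L) / l ^ 2 := by gcongr
      _ = _ := by field_simp; ring
  have e3 : (1 + 100 * g / l) * (L / (2 * l)) =
      (1 + 34 * g / l) * (L / (2 * l)) + 66 * g / l * (L / (2 * l)) := by ring
  linarith

/-! ### The sharp threshold -/

theorem IsSubpolynomial.tendsto_log_div_log {Δ : ℕ → ℕ} (h : IsSubpolynomial Δ) :
    Tendsto (fun n => Real.log (Δ n) / Real.log n) atTop (𝓝 0) := by
  obtain ⟨e, he, hΔ⟩ := h
  refine he.congr' ?_
  filter_upwards [hΔ, tendsto_log_natCast.eventually_gt_atTop 0, eventually_gt_atTop 0]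
    with n hn hl hn0
  rw [hn, Real.log_rpow (by exact_mod_cast hn0), mul_div_cancel_right₀ _ hl.ne']

theorem tendsto_log_mul_log_div_log {Δ : ℕ → ℕ} (hΔ : ∀ᶠ n in atTop, 3 ≤ Δ n)
    (hsub : IsSubpolynomial Δ) :
    Tendsto (fun n : ℕ => Real.log ((Δ n : ℝ) * Real.log n) / Real.log n) atTop (𝓝 0) := by
  have h1 : Tendsto (fun n : ℕ => Real.log (Real.log n) / Real.log n) atTop (𝓝 0) :=
    (Real.isLittleO_log_id_atTop.tendsto_div_nhds_zero).comp tendsto_log_natCast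
  have h2 := hsub.tendsto_log_div_log.add h1
  rw [add_zero] at h2
  refine h2.congr' ?_
  filter_upwards [hΔ, tendsto_log_natCast.eventually_gt_atTop 0] with n hn hl
  have : (Δ n : ℝ) ≠ 0 := by
    have : Δ n ≠ 0 := by omega
    exact_mod_cast this
  rw [Real.log_mul this hl.ne', add_div]

theorem criticalRadius_nonneg {d n Δ : ℕ} (hΔ : 3 ≤ Δ) (hn : 0 < Real.log n) :
    0 ≤ criticalRadius d n Δ := by
  have : (3 : ℝ) ≤ Δ := by exact_mod_cast hΔ
  have := Real.log_nonneg (by linarith : (1 : ℝ) ≤ (Δ : ℝ) - 1)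
  unfold criticalRadius
  positivity

theorem theorem1 (d : ℕ) (hd : 1 ≤ d) (Δ : ℕ → ℕ)
    (hΔ : ∀ᶠ n in atTop, 3 ≤ Δ n) (hsub : IsSubpolynomial Δ) :
    IsSharpThreshold d (fun n G => IsTreeUniversal n (Δ n) G)
      (fun n => criticalRadius d n (Δ n)) ∧
    ∀ r : ℕ → ℝ,
      ((∀ᶠ n : ℕ in atTop,
          r n ≤ (1 - Real.log ((Δ n : ℝ) - 1) / Real.log n) * criticalRadius d n (Δ n)) →
        Tendsto (fun n => rggProb d n (r n) (fun G => IsTreeUniversal n (Δ n) G))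
          atTop (𝓝 0)) ∧
      ((∀ᶠ n : ℕ in atTop,
          (1 + 100 * (d : ℝ) * Real.log ((Δ n : ℝ) * Real.log n) / Real.log n)
            * criticalRadius d n (Δ n) ≤ r n) →
        Tendsto (fun n => rggProb d n (r n) (fun G => IsTreeUniversal n (Δ n) G))
          atTop (𝓝 1)) := by
  have hlog := tendsto_log_natCast
  have hlim := tendsto_log_mul_log_div_log hΔ hsub
  have hd0 : (0 : ℝ) < d := by exact_mod_cast hd
  have hlarge : ∀ᶠ n : ℕ in atTop,
      34 * d * Real.log ((Δ n : ℝ) * Real.log n) ≤ Real.log n := by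
    filter_upwards [hlim.eventually_le_const (by positivity : (0 : ℝ) < 1 / (34 * d)),
      hlog.eventually_gt_atTop 0] with n hn hl
    rw [div_le_div_iff₀ hl (by positivity)] at hn
    linarith
  have hle : ∀ᶠ n : ℕ in atTop, Real.log ((Δ n : ℝ) - 1) / Real.log n ≤
      Real.log ((Δ n : ℝ) * Real.log n) / Real.log n := by
    filter_upwards [hΔ, hlog.eventually_ge_atTop 1] with n hn hl
    have : (3 : ℝ) ≤ Δ n := by exact_mod_cast hn
    gcongr
    · linarith
    · nlinarith
  have hsplit : ∀ n, 3 ≤ Δ n → ∃ k, 2 ≤ k ∧ Δ n = k + 1 ∧ (Δ n : ℝ) = k + 1 ∧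
      (Δ n : ℝ) - 1 = k := by
    intro n hn
    obtain ⟨k, hk⟩ := Nat.exists_eq_add_of_le hn
    refine ⟨k + 2, by omega, by omega, ?_, ?_⟩ <;> rw [hk] <;> push_cast <;> ring
  have hprecise : ∀ r : ℕ → ℝ,
      ((∀ᶠ n : ℕ in atTop,
          r n ≤ (1 - Real.log ((Δ n : ℝ) - 1) / Real.log n) * criticalRadius d n (Δ n)) →
        Tendsto (fun n => rggProb d n (r n) (fun G => IsTreeUniversal n (Δ n) G))
          atTop (𝓝 0)) ∧
      ((∀ᶠ n : ℕ in atTop,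
          (1 + 100 * (d : ℝ) * Real.log ((Δ n : ℝ) * Real.log n) / Real.log n)
            * criticalRadius d n (Δ n) ≤ r n) →
        Tendsto (fun n => rggProb d n (r n) (fun G => IsTreeUniversal n (Δ n) G))
          atTop (𝓝 1)) := by
    intro r
    constructor
    · intro hr
      refine tendsto_rggProb_zero ?_
      filter_upwards [hr, hΔ, hlarge, hle, hlim.eventually_le_const zero_lt_one,
        hlog.eventually_ge_atTop 6] with n hr hΔ hlarge hle hle1 hl x hx
      obtain ⟨k, hk, hΔk, hΔk', hΔk1⟩ := hsplit n hΔ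
      rw [criticalRadius, hΔk1] at hr
      rw [hΔk1] at hle
      rw [hΔk'] at hlarge hle hle1
      rw [hΔk]
      exact not_isTreeUniversal_of_le hd hk hl (hle.trans hle1)
        (isTreeUniversal_of_le hd hk hl hlarge hx le_rfl).1 hx hr
    · intro hr
      refine tendsto_rggProb_one ?_
      filter_upwards [hr, hΔ, hlarge, hlog.eventually_ge_atTop 6] with n hr hΔ hlarge hl x hx
      obtain ⟨k, hk, hΔk, hΔk', hΔk1⟩ := hsplit n hΔ
      rw [criticalRadius, hΔk1, hΔk'] at hr
      rw [hΔk'] at hlarge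
      rw [hΔk]
      exact (isTreeUniversal_of_le hd hk hl hlarge hx hr).2
  refine ⟨fun ε hε r => ⟨fun hr => (hprecise r).1 ?_, fun hr => (hprecise r).2 ?_⟩, hprecise⟩
  · filter_upwards [hr, hΔ, hle, hlim.eventually_le_const hε, hlog.eventually_gt_atTop 0]
      with n hr hΔ hle hε hl
    refine hr.trans (mul_le_mul_of_nonneg_right ?_ (criticalRadius_nonneg hΔ hl))
    linarith
  · filter_upwards [hr, hΔ, hlim.eventually_le_const (by positivity : 0 < ε / (100 * d)),
      hlog.eventually_gt_atTop 0] with n hr hΔ hε hl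
    refine le_trans (mul_le_mul_of_nonneg_right ?_ (criticalRadius_nonneg hΔ hl)) hr
    rw [le_div_iff₀ (by positivity)] at hε
    rw [mul_div_assoc]
    linarith
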